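/- Let $m,n\in\mathbb N$, $0<\alpha<mn$, $0<\gamma\le 1$, and let $T_\alpha^m\vec f(x)=\int_{(\mathbb R^n)^m}K_\alpha(x,\vec y)\prod_{i=1}^m f_i(y_i)\,d\vec y$, where the measurable kernel $K_\alpha$ satisfies, for some constants $A,c>0$ (and away from the points where $y_1=\dots=y_m$ equals $x$ or $x'$), $$|K_\alpha(x,\vec y)|\le \frac{A}{(\sum_{i}|x-y_i|)^{mn-\alpha}},\qquad |K_\alpha(x,\vec y)-K_\alpha(x',\vec y)|\le \frac{A\,|x-x'|^\gamma}{(\sum_{i}|x-y_i|)^{mn-\alpha+\gamma}}\ \text{ whenever } \sum_{i}|x-y_i|>c|x-x'|.$$ A weight is a locally integrable function on $\mathbb R^n$ that is positive and finite a.e.; $|B|$ is Lebesgue measure, $w^{-1}(B)=\int_B w^{-1}$, and $B=B(x_B,R)$ always denotes a ball. Let $0<\delta<\min\{\gamma,mn-\alpha\}$, $\tilde\alpha=\alpha+\delta$, $\tilde\delta\le\delta$, and let $\vec p=(p_1,\dots,p_m)$ with $1\le p_i\le\infty$ and $1/p=\sum_i 1/p_i$ satisfy $p>n/\tilde\alpha$.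 Let $p_i'$ be the conjugate exponent of $p_i$. Let $b_1,\dots,b_m$ satisfy $|b_i(x)-b_i(y)|\le C_b|x-y|^\delta$ for all $x,y$ and some $C_b$ (that is, $b_i\in\Lambda(\delta)$). Let $w,v_1,\dots,v_m$ be weights with $(w,\vec v)\in\mathcal H_m(\vec p,\tilde\alpha,\tilde\delta)$, that is, $w^{-1}(B)<\infty$ for every ball $B$ and there are numbers $0<\tilde\alpha_i<n$ with $\sum_i\tilde\alpha_i=\tilde\alpha$ and a constant $C_0$ with $$\frac{|B|^{1+(\delta-\tilde\delta)/n}}{w^{-1}(B)}\prod_{i=1}^m\left\|\frac{v_i^{-1}}{(|B|^{1/n}+|x_B-\cdot|)^{n-\tilde\alpha_i+\delta/m}}\right\|_{p_i'}\le C_0\quad\text{for every ball } B.$$ Assume moreover that, for every $i$ with $1<p_i\le\infty$, $v_i^{-p_i'}\in\mathrm{RH}_m$, that is, $u=v_i^{-p_i'}$ is a weight for which there is a constant $C_1$ with $\left(\frac1{|B|}\int_B u^m\right)^{1/m}\le \frac{C_1}{|B|}\int_B u$ for every ball $B$. Consider the sum-type commutator $$T^m_{\alpha,\bm b}\vec f(x)=\sum_{j=1}^m\int_{(\mathbb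 R^n)^m}(b_j(x)-b_j(y_j))K_\alpha(x,\vec y)\prod_{i=1}^m f_i(y_i)\,d\vec y .$$ When the integrals do not converge absolutely for a.e. $x$, $T^m_{\alpha,\bm b}\vec f$ is understood modulo additive constants, as a function $F$ such that, for a.e. $z$ and a.e. $x$, $$F(x)-F(z)=\sum_{j=1}^m\int_{(\mathbb R^n)^m}\bigl[(b_j(x)-b_j(y_j))K_\alpha(x,\vec y)-(b_j(z)-b_j(y_j))K_\alpha(z,\vec y)\bigr]\prod_{i=1}^m f_i(y_i)\,d\vec y ,$$ with absolutely convergent integrals. Then $T^m_{\alpha,\bm b}$ is bounded from $\prod_i L^{p_i}(v_i^{p_i})$ into $\mathcal L_w(\tilde\delta)$: there is a constant $C>0$ such that, for every $\vec f$ with $f_iv_i\in L^{p_i}$ for $1\le i\le m$, the function $T^m_{\alpha,\bm b}\vec f$ is well defined in this sense and locally integrable, and $$\frac{1}{w^{-1}(B)\,|B|^{\tilde\delta/n}}\int_B\bigl|T^m_{\alpha,\bm b}\vec f(x)-(T^m_{\alpha,\bm b}\vec f)_B\bigr|\,dx\le C\prod_{i=1}^m\|f_iv_i\|_{p_i}\quad\text{for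 every ball } B,$$ where $(g)_B=\frac1{|B|}\int_B g$. If the integrals that define $T^m_{\alpha,\bm b}\vec f(x)$ converge absolutely for a.e. $x$, this holds for $T^m_{\alpha,\bm b}\vec f$ itself, with no modification by constants. -/

import Mathlib

open MeasureTheory
open scoped ENNReal NNReal

namespace MultiFrac

noncomputable section

/-- The Euclidean space `ℝⁿ`. -/
abbrev Rn (n : ℕ) : Type := EuclideanSpace ℝ (Fin n)

/-- A weight: a locally integrable function that is positive (and finite) almost everywhere. -/
def IsWeight {n : ℕ} (w : Rn n → ℝ) : Prop :=
  LocallyIntegrable w volume ∧ ∀ᵐ x, 0 < w x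

/-- `w⁻¹(B) = ∫_B w⁻¹`. -/
def invMass {n : ℕ} (w : Rn n → ℝ) (B : Set (Rn n)) : ℝ≥0∞ :=
  ∫⁻ x in B, ENNReal.ofReal (w x)⁻¹

/-- The reverse Hölder class `RH_s`. For `s = 1` the inequality holds for every weight. -/
def MemRH {n : ℕ} (s : ℝ) (w : Rn n → ℝ) : Prop :=
  IsWeight w ∧ ∃ C : ℝ≥0, ∀ (x₀ : Rn n) (R : ℝ), 0 < R →
    ((∫⁻ x in Metric.ball x₀ R, ENNReal.ofReal (w x) ^ s) / volume (Metric.ball x₀ R)) ^ (1 / s) ≤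
      C * ((∫⁻ x in Metric.ball x₀ R, ENNReal.ofReal (w x)) / volume (Metric.ball x₀ R))

/-- The exponent `p` with `1 / p = ∑ 1 / p_i`. -/
def totalExponent {m : ℕ} (p : Fin m → ℝ≥0∞) : ℝ≥0∞ := (∑ i, (p i)⁻¹)⁻¹

/-- The class `ℋ_m(p⃗, β, δ')`, with the auxiliary parameter `δ` made explicit. The measure
`w⁻¹(B)`, by which one divides, is required to be finite for every ball `B`. The conjugate
exponent is `∞` for `p_i = 1` and `1` for `p_i = ∞`. -/
def MemH {n m : ℕ} (p : Fin m → ℝ≥0∞) (β δ δ' : ℝ) (w : Rn n → ℝ) (v : Fin m → Rn n → ℝ) :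
    Prop :=
  (∀ (x₀ : Rn n) (R : ℝ), 0 < R → invMass w (Metric.ball x₀ R) < ∞) ∧
  ∃ β' : Fin m → ℝ, (∀ i, 0 < β' i ∧ β' i < n) ∧ ∑ i, β' i = β ∧
    ∃ C : ℝ≥0, ∀ (x₀ : Rn n) (R : ℝ), 0 < R →
      volume (Metric.ball x₀ R) ^ (1 + (δ - δ') / n) / invMass w (Metric.ball x₀ R) *
        ∏ i, eLpNorm
          (fun y => (v i y)⁻¹ /
            (volume.real (Metric.ball x₀ R) ^ (1 / (n : ℝ)) + ‖x₀ - y‖) ^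
              ((n : ℝ) - β' i + δ / m))
          (p i).conjExponent volume ≤ C

section Operators

variable {𝕜 : Type*} [RCLike 𝕜] {n m : ℕ}

/-- The quantity `|x - y_1| + ... + |x - y_m|`. -/
def sumDist (x : Rn n) (y : Fin m → Rn n) : ℝ := ∑ i, ‖x - y i‖

/-- Kernels of multilinear fractional operators: the size condition and the smoothness condition
of order `γ`. Nothing is asked about the value of `K x` at the singular point `(x, ..., x)`. -/
structure IsFractionalKernel (α γ : ℝ) (K : Rn n → (Fin m → Rn n) → 𝕜) : Prop where
  measurable : AEStronglyMeasurable (fun z : Rn n × (Fin m → Rn n) => K z.1 z.2) volume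
  size : ∃ C : ℝ, ∀ x y, 0 < sumDist x y →
    ‖K x y‖ ≤ C / sumDist x y ^ ((m : ℝ) * n - α)
  smooth : ∃ c C : ℝ, 0 < c ∧ ∀ x x' y, 0 < sumDist x' y → c * ‖x - x'‖ < sumDist x y →
    ‖K x y - K x' y‖ ≤ C * ‖x - x'‖ ^ γ / sumDist x y ^ ((m : ℝ) * n - α + γ)

/-- The Lipschitz space `Λ(δ)`. -/
def MemLambda (δ : ℝ) (b : Rn n → 𝕜) : Prop :=
  ∃ C : ℝ, ∀ x y, ‖b x - b y‖ ≤ C * ‖x - y‖ ^ δ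

/-- The operator with kernel `K`. -/
def fracOp (K : Rn n → (Fin m → Rn n) → 𝕜) (f : Fin m → Rn n → 𝕜) (x : Rn n) : 𝕜 :=
  ∫ y : Fin m → Rn n, K x y * ∏ i, f i (y i)

/-- The integrand in the integral representation of the commutator of `b_j` with the operator of
kernel `K`, on the `j`-th entry. -/
def commIntegrand (K : Rn n → (Fin m → Rn n) → 𝕜) (b f : Fin m → Rn n → 𝕜) (j : Fin m)
    (x : Rn n) (y : Fin m → Rn n) : 𝕜 :=
  (b j x - b j (y j)) * K x y * ∏ i, f i (y i)

/-- The sum-type commutator, the sum over `j` of the commutators of `b_j` on the `j`-th entry. -/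
def sumCommutator (K : Rn n → (Fin m → Rn n) → 𝕜) (b f : Fin m → Rn n → 𝕜) (x : Rn n) : 𝕜 :=
  ∑ j, ∫ y : Fin m → Rn n, commIntegrand K b f j x y

/-- The integrals that define `sumCommutator K b f` converge absolutely at almost every point. -/
def CommConverges (K : Rn n → (Fin m → Rn n) → 𝕜) (b f : Fin m → Rn n → 𝕜) : Prop :=
  ∀ j, ∀ᵐ x, Integrable (commIntegrand K b f j x) volume

/-- `F` is the commutator of `f` modulo constants: the increments of `F` are those of the
commutator, the difference being taken inside the integrals, where it converges absolutely. -/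
def IsCommModConst (K : Rn n → (Fin m → Rn n) → 𝕜) (b f : Fin m → Rn n → 𝕜) (F : Rn n → 𝕜) :
    Prop :=
  ∀ᵐ z, ∀ᵐ x,
    (∀ j, Integrable (fun y => commIntegrand K b f j x y - commIntegrand K b f j z y) volume) ∧
    F x - F z =
      ∑ j, ∫ y : Fin m → Rn n, (commIntegrand K b f j x y - commIntegrand K b f j z y)

/-- The seminorm of the weighted Lipschitz space `ℒ_w(δ)`. -/
def lipSeminorm (w : Rn n → ℝ) (δ : ℝ) (F : Rn n → 𝕜) : ℝ≥0∞ :=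
  ⨆ (x₀ : Rn n) (R : ℝ) (_ : 0 < R),
    (∫⁻ x in Metric.ball x₀ R, ‖F x - ⨍ z in Metric.ball x₀ R, F z‖ₑ) /
      (invMass w (Metric.ball x₀ R) * volume (Metric.ball x₀ R) ^ (δ / n))

/-- The weighted Lipschitz space `ℒ_w(δ)`. -/
def MemLip (w : Rn n → ℝ) (δ : ℝ) (F : Rn n → 𝕜) : Prop :=
  LocallyIntegrable F volume ∧ lipSeminorm w δ F < ∞

/-- Where the integrals converge, `sumCommutator` is `∑ j, (b_j T f - T(f_1, ..., b_j f_j, ..., f_m))`. -/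
theorem sumCommutator_eq (K : Rn n → (Fin m → Rn n) → 𝕜) (b f : Fin m → Rn n → 𝕜) (x : Rn n)
    (h₁ : Integrable (fun y : Fin m → Rn n => K x y * ∏ i, f i (y i)) volume)
    (h₂ : ∀ j, Integrable (fun y : Fin m → Rn n =>
      K x y * ∏ i, Function.update f j (fun t => b j t * f j t) i (y i)) volume) :
    sumCommutator K b f x =
      ∑ j, (b j x * fracOp K f x -
        fracOp K (Function.update f j (fun t => b j t * f j t)) x) := by
  unfold sumCommutator fracOp
  refine Finset.sum_congr rfl fun j _ => ?_
  rw [← integral_const_mul, ← integral_sub (h₁.const_mul _) (h₂ j)]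
  refine integral_congr_ae (Filter.Eventually.of_forall fun y => ?_)
  have e : ∏ i, Function.update f j (fun t => b j t * f j t) i (y i)
      = b j (y j) * ∏ i, f i (y i) := by
    rw [← Finset.mul_prod_erase _ _ (Finset.mem_univ j),
      ← Finset.mul_prod_erase (Finset.univ) (fun i => f i (y i)) (Finset.mem_univ j),
      Function.update_self, mul_assoc]
    congr 2
    refine Finset.prod_congr rfl fun i hi => ?_
    rw [Function.update_of_ne (Finset.ne_of_mem_erase hi)]
  simp only [commIntegrand, e]
  ring

end Operators

end

end MultiFrac

open MultiFrac

/-!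
The commutator has the kernels `(b_j(x) - b_j(y_j)) K(x, y)`, and everything rests on the increment
of such a kernel between two points `x`, `z` of a ball `B = B(x₀, R)`.

* If some `y_i` lies outside `2B = B(x₀, 2R)`, write the increment as
  `(b_j(x) - b_j(z)) K(x, y) + (b_j(z) - b_j(y_j)) (K(x, y) - K(z, y))`. As the smoothness `γ` of the
  kernel exceeds `δ`, both terms are at most `R ^ δ (R + ∑ |x₀ - y_i|) ^ (-(m n - α))`
  (`exists_norm_increment_le`). The exponents `e_i` of the weighted norms in the class `ℋ_m` add up
  to `m n - α`, so Hölder's inequality in each `y_i` bounds this part by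
  `R ^ δ ∏ ‖f_i v_i‖ N_i`, where `N_i` is the `i`-th norm in `ℋ_m` (`weightNorm`).
* If all `y_i` are in `2B`, the two terms of the increment are estimated separately. The factor
  `b_j(x) - b_j(y_j)` raises the order of the kernel to `α + δ`, and the result is dominated by the
  product over `i` of the fractional integrals of `f_i` of orders `β_i`, for any `β_i ≤ n` with
  `∑ β_i = α + δ` (`exists_enorm_sub_mul_kernel_le`, `fracMajorant`). The reverse Hölder condition
  puts `f_i` in `L^{q_i}(2B)` with `1 / q_i = 1 / m + (1 - 1 / m) / p_i`
  (`exists_lintegral_ball_rpow_le`), and the fractional integral of order `β_i` maps `L^{q_i}(2B)` to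
  `L^m(B)` as soon as `β_i > n (1 - 1 / m) / p_i` (`exists_fractional_ball_le`). Because
  `1 / p < (α + δ) / n < m`, such `β_i` exist (`exists_fractional_orders`). Hölder's inequality with
  `m` exponents `m` then bounds the integral of the product over `B` by
  `R ^ (n + δ) ∏ ‖f_i v_i‖ N_i` (`exists_lintegral_fracMajorant_le`).

Both parts of the mean oscillation are thus at most a multiple of `R ^ (n + δ) ∏ ‖f_i v_i‖ N_i`, and
the condition `ℋ_m` says exactly that `R ^ (n + δ) ∏ N_i` is at most a multiple of
`w⁻¹(B) |B| ^ (δ' / n)` (`MemH.exists_weightNorm_le`). The same estimates show that the increments of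
the integrands are integrable for almost all pairs of points, so that normalization at one point
gives a commutator modulo constants.
-/

namespace MultiFrac

/-! ### Young's inequality and fractional kernels on balls -/

/-- Tonelli's theorem for a product of functions of one coordinate each. -/
theorem lintegral_pi_prod {X : Type*} [MeasurableSpace X] :
    ∀ {m : ℕ} (μ : Fin m → Measure X) [∀ i, SigmaFinite (μ i)] (f : Fin m → X → ℝ≥0∞),
      (∀ i, AEMeasurable (f i) (μ i)) →
      ∫⁻ y, ∏ i, f i (y i) ∂Measure.pi μ = ∏ i, ∫⁻ x, f i x ∂μ i
  | 0, μ, _, f, _ => by simp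
  | k + 1, μ, _, f, hf => by
    have e := (measurePreserving_piFinSuccAbove μ 0).symm
    have ih := lintegral_pi_prod (fun i : Fin k => μ i.succ) (fun i => f i.succ) (fun i => hf _)
    have hm : AEMeasurable (fun y : Fin k → X => ∏ i, f i.succ (y i))
        (Measure.pi fun i : Fin k => μ i.succ) :=
      Finset.aemeasurable_fun_prod _ fun i _ => (hf i.succ).comp_quasiMeasurePreserving
        (Measure.quasiMeasurePreserving_eval (fun i : Fin k => μ i.succ) i)
    calc ∫⁻ y, ∏ i, f i (y i) ∂Measure.pi μ
        = ∫⁻ a : X × (Fin k → X), f 0 a.1 * ∏ i, f i.succ (a.2 i)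
            ∂(μ 0).prod (Measure.pi fun i => μ i.succ) := by
          rw [← e.lintegral_comp_emb (MeasurableEquiv.measurableEmbedding _)]
          refine lintegral_congr fun a => ?_
          rw [Fin.prod_univ_succ]
          rfl
      _ = _ := by
          rw [lintegral_prod_mul (hf 0) hm, ih, Fin.prod_univ_succ]

/-- Young's inequality in Schur's form: a kernel whose `L^s` norms in each variable are at most
`M ^ (1 / s)` maps `L^q` to `L^r` when `1 / s + 1 / q = 1 + 1 / r`. -/
theorem lintegral_kernel_rpow_le {X Y : Type*} [MeasurableSpace X] [MeasurableSpace Y]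
    {μ : Measure X} {ν : Measure Y} [SFinite μ] [SFinite ν] {k : X → Y → ℝ≥0∞}
    (hk : Measurable (Function.uncurry k)) {g : Y → ℝ≥0∞} (hg : AEMeasurable g ν)
    {r s q : ℝ} (hr : 0 < r) (hs : 0 < s) (hq : 0 < q) (hsr : s ≤ r) (hqr : q ≤ r)
    (h : 1 / s + 1 / q = 1 + 1 / r) {M : ℝ≥0∞}
    (hM₁ : ∀ᵐ x ∂μ, ∫⁻ y, k x y ^ s ∂ν ≤ M) (hM₂ : ∀ᵐ y ∂ν, ∫⁻ x, k x y ^ s ∂μ ≤ M) :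
    (∫⁻ x, (∫⁻ y, k x y * g y ∂ν) ^ r ∂μ) ^ (1 / r) ≤
      M ^ (1 / s) * (∫⁻ y, g y ^ q ∂ν) ^ (1 / q) := by
  set G := ∫⁻ y, g y ^ q ∂ν with hG
  set a := 1 / r with ha
  set b := 1 / s - 1 / r with hb
  set c := 1 / q - 1 / r with hc
  have ha0 : 0 < a := by positivity
  have hb0 : 0 ≤ b := sub_nonneg.2 (one_div_le_one_div_of_le hs hsr)
  have hc0 : 0 ≤ c := sub_nonneg.2 (one_div_le_one_div_of_le hq hqr)
  have habc : a + b + c = 1 := by simp only [ha, hb, hc]; linarith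
  have hkx : ∀ x, Measurable (k x) := fun x => hk.comp measurable_prodMk_left
  -- Hölder with the factors `(k^s g^q)^a`, `(k^s)^b`, `(g^q)^c`
  have point : ∀ᵐ x ∂μ, (∫⁻ y, k x y * g y ∂ν) ^ r ≤
      (∫⁻ y, k x y ^ s * g y ^ q ∂ν) * (M ^ (b * r) * G ^ (c * r)) := by
    filter_upwards [hM₁] with x hx
    have H := ENNReal.lintegral_prod_norm_pow_le (μ := ν) Finset.univ
      (f := ![fun y => k x y ^ s * g y ^ q, fun y => k x y ^ s, fun y => g y ^ q])
      (p := ![a, b, c])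
      (by
        intro i _
        fin_cases i
        · exact ((hkx x).pow_const s).aemeasurable.mul (hg.pow_const q)
        · exact ((hkx x).pow_const s).aemeasurable
        · exact hg.pow_const q)
      (by simp [Fin.sum_univ_three, habc])
      (by intro i _; fin_cases i <;> simp [ha0.le, hb0, hc0])
    simp only [Fin.prod_univ_three, Matrix.cons_val_zero, Matrix.cons_val_one,
      Matrix.cons_val] at H
    have eq : ∀ y, (k x y ^ s * g y ^ q) ^ a * (k x y ^ s) ^ b * (g y ^ q) ^ c =
        k x y * g y := by
      intro y
      rw [ENNReal.mul_rpow_of_nonneg _ _ ha0.le, ← ENNReal.rpow_mul, ← ENNReal.rpow_mul,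
        ← ENNReal.rpow_mul, ← ENNReal.rpow_mul]
      have e₁ : k x y = k x y ^ (s * a) * k x y ^ (s * b) := by
        rw [← ENNReal.rpow_add_of_nonneg _ _ (by positivity) (by positivity),
          show s * a + s * b = 1 by simp only [ha, hb]; field_simp; ring, ENNReal.rpow_one]
      have e₂ : g y = g y ^ (q * a) * g y ^ (q * c) := by
        rw [← ENNReal.rpow_add_of_nonneg _ _ (by positivity) (by positivity),
          show q * a + q * c = 1 by simp only [ha, hc]; field_simp; ring, ENNReal.rpow_one]
      conv_rhs => rw [e₁, e₂]
      ring
    simp only [eq] at H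
    calc (∫⁻ y, k x y * g y ∂ν) ^ r
        ≤ ((∫⁻ y, k x y ^ s * g y ^ q ∂ν) ^ a * M ^ b * G ^ c) ^ r := by
          gcongr
          refine H.trans ?_
          gcongr
      _ = _ := by
          rw [ENNReal.mul_rpow_of_nonneg _ _ hr.le, ENNReal.mul_rpow_of_nonneg _ _ hr.le,
            ← ENNReal.rpow_mul, ← ENNReal.rpow_mul, ← ENNReal.rpow_mul,
            show a * r = 1 by simp only [ha]; field_simp, ENNReal.rpow_one, mul_assoc]
  have hkg : AEMeasurable (Function.uncurry fun x y => k x y ^ s * g y ^ q) (μ.prod ν) :=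
    (hk.pow_const s).aemeasurable.mul (hg.pow_const q).comp_snd
  have swap : ∫⁻ x, ∫⁻ y, k x y ^ s * g y ^ q ∂ν ∂μ ≤ M * G := by
    rw [lintegral_lintegral_swap hkg, hG, ← lintegral_const_mul'' _ (hg.pow_const q)]
    refine lintegral_mono_ae ?_
    filter_upwards [hM₂] with y hy
    have hky : Measurable fun x => k x y := hk.comp measurable_prodMk_right
    rw [lintegral_mul_const _ (hky.pow_const s)]
    gcongr
  calc (∫⁻ x, (∫⁻ y, k x y * g y ∂ν) ^ r ∂μ) ^ a
      ≤ (∫⁻ x, (∫⁻ y, k x y ^ s * g y ^ q ∂ν) * (M ^ (b * r) * G ^ (c * r)) ∂μ) ^ a :=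
        ENNReal.rpow_le_rpow (lintegral_mono_ae point) ha0.le
    _ ≤ (M * G * (M ^ (b * r) * G ^ (c * r))) ^ a := by
        have hm : AEMeasurable (fun x => ∫⁻ y, k x y ^ s * g y ^ q ∂ν) μ := hkg.lintegral_prod_right'
        rw [lintegral_mul_const'' _ hm]
        gcongr
    _ = M ^ (1 / s) * G ^ (1 / q) := by
        rw [ENNReal.mul_rpow_of_nonneg _ _ ha0.le, ENNReal.mul_rpow_of_nonneg _ _ ha0.le,
          ENNReal.mul_rpow_of_nonneg _ _ ha0.le, ← ENNReal.rpow_mul, ← ENNReal.rpow_mul,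
          show b * r * a = b by simp only [ha]; field_simp,
          show c * r * a = c by simp only [ha]; field_simp,
          show 1 / s = a + b by simp only [ha, hb]; ring,
          show 1 / q = a + c by simp only [ha, hc]; ring,
          ENNReal.rpow_add_of_nonneg _ _ ha0.le hb0, ENNReal.rpow_add_of_nonneg _ _ ha0.le hc0]
        ring

theorem volume_ball_eq {n : ℕ} (hn : 0 < n) (x₀ : Rn n) {R : ℝ} (hR : 0 < R) :
    volume (Metric.ball x₀ R) =
      ENNReal.ofReal R ^ (n : ℝ) * volume (Metric.ball (0 : Rn n) 1) := by
  have : Nonempty (Fin n) := ⟨⟨0, hn⟩⟩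
  rw [Measure.addHaar_ball _ _ hR.le, ENNReal.ofReal_pow hR.le, ENNReal.rpow_natCast]
  simp

/-- The integral of `‖z‖ ^ t` over a ball around the origin, by scaling. -/
theorem lintegral_ball_enorm_rpow {n : ℕ} (t : ℝ) {R : ℝ} (hR : 0 < R) :
    ∫⁻ z in Metric.ball (0 : Rn n) R, ‖z‖ₑ ^ t =
      ENNReal.ofReal R ^ (n + t) * ∫⁻ z in Metric.ball (0 : Rn n) 1, ‖z‖ₑ ^ t := by
  have hR0 : ENNReal.ofReal R ≠ 0 := by simpa using hR
  have hm : Measurable fun z : Rn n => ‖z‖ₑ ^ t := measurable_enorm.pow_const t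
  have key : ∫⁻ z, (Metric.ball (0 : Rn n) R).indicator (fun z => ‖z‖ₑ ^ t) z
        ∂(Measure.map (R • ·) volume) =
      ∫⁻ z, (Metric.ball (0 : Rn n) R).indicator (fun z => ‖z‖ₑ ^ t) (R • z) :=
    lintegral_map (hm.indicator Metric.isOpen_ball.measurableSet) (measurable_const_smul R)
  rw [Measure.map_addHaar_smul _ hR.ne', lintegral_smul_measure,
    lintegral_indicator Metric.isOpen_ball.measurableSet] at key
  have e : ∀ z : Rn n, (Metric.ball (0 : Rn n) R).indicator (fun z => ‖z‖ₑ ^ t) (R • z) =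
      ENNReal.ofReal R ^ t * (Metric.ball (0 : Rn n) 1).indicator (fun z => ‖z‖ₑ ^ t) z := by
    intro z
    have hz : R • z ∈ Metric.ball (0 : Rn n) R ↔ z ∈ Metric.ball (0 : Rn n) 1 := by
      simp only [mem_ball_zero_iff, norm_smul, Real.norm_eq_abs, abs_of_pos hR]
      exact mul_lt_iff_lt_one_right hR
    by_cases h : z ∈ Metric.ball (0 : Rn n) 1
    · rw [Set.indicator_of_mem (hz.2 h), Set.indicator_of_mem h, enorm_smul,
        Real.enorm_eq_ofReal hR.le, ENNReal.mul_rpow_of_ne_top (by simp) (by simp)]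
    · rw [Set.indicator_of_notMem (mt hz.1 h), Set.indicator_of_notMem h, mul_zero]
  simp only [e] at key
  rw [lintegral_const_mul _ (hm.indicator Metric.isOpen_ball.measurableSet),
    lintegral_indicator Metric.isOpen_ball.measurableSet] at key
  have e₂ : ENNReal.ofReal |(R ^ Module.finrank ℝ (Rn n))⁻¹| = (ENNReal.ofReal R ^ (n : ℝ))⁻¹ := by
    rw [abs_of_pos (by positivity), ENNReal.ofReal_inv_of_pos (by positivity),
      ENNReal.ofReal_pow hR.le, ENNReal.rpow_natCast]
    simp
  rw [e₂, smul_eq_mul] at key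
  rw [ENNReal.rpow_add _ _ hR0 ENNReal.ofReal_ne_top, mul_assoc, ← key, ← mul_assoc,
    ENNReal.mul_inv_cancel, one_mul]
  · simp [hR]
  · simp

theorem lintegral_unitBall_enorm_rpow_lt_top {n : ℕ} (hn : 0 < n) {t : ℝ} (ht : -(n : ℝ) < t) :
    ∫⁻ z in Metric.ball (0 : Rn n) 1, ‖z‖ₑ ^ t < ∞ := by
  have : Nonempty (Fin n) := ⟨⟨0, hn⟩⟩
  have h := integrableOn_ball_of_norm_le_rpow (E := Rn n) (F := ℝ) (μ := volume)
    (f := fun z => ‖z‖ ^ t) (C := 1) (α := -t) (r := 1) (by simpa using Nat.succ_le_of_lt hn)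
    (by simp; linarith) (Filter.Eventually.of_forall fun z => by
      simp [abs_of_nonneg (Real.rpow_nonneg (norm_nonneg z) t)])
    (measurable_norm.pow_const t).aestronglyMeasurable
  refine lt_of_le_of_lt (le_of_eq (lintegral_congr_ae ?_)) h.2
  have h0 : ∀ᵐ z : Rn n ∂volume.restrict (Metric.ball 0 1), z ≠ 0 :=
    ae_restrict_of_ae (by simp [ae_iff])
  filter_upwards [h0] with z hz
  rw [Real.enorm_eq_ofReal (by positivity), ← ofReal_norm,
    ENNReal.ofReal_rpow_of_pos (norm_pos_iff.2 hz)]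

/-- A fractional kernel over a ball, seen from a point at distance less than `R` from the ball. -/
theorem lintegral_ball_enorm_sub_rpow_le {n : ℕ} (t : ℝ) {R S : ℝ} (hS : 0 < S)
    {x x₀ : Rn n} (hx : ∀ y ∈ Metric.ball x₀ R, ‖x - y‖ < S) :
    ∫⁻ y in Metric.ball x₀ R, ‖x - y‖ₑ ^ t ≤
      ENNReal.ofReal S ^ (n + t) * ∫⁻ z in Metric.ball (0 : Rn n) 1, ‖z‖ₑ ^ t := by
  rw [← lintegral_ball_enorm_rpow t hS, ← lintegral_indicator Metric.isOpen_ball.measurableSet,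
    ← lintegral_indicator Metric.isOpen_ball.measurableSet]
  rw [← lintegral_sub_left_eq_self (μ := (volume : Measure (Rn n)))
    ((Metric.ball (0 : Rn n) S).indicator fun z => ‖z‖ₑ ^ t) x]
  refine lintegral_mono fun y => ?_
  by_cases hy : y ∈ Metric.ball x₀ R
  · rw [Set.indicator_of_mem hy, Set.indicator_of_mem (by simpa using hx y hy)]
  · rw [Set.indicator_of_notMem hy]
    exact zero_le

/-! ### Local integrability from the weights -/

/-- The factor of the class `ℋ_m` that belongs to one weight, for the ball `B(x₀, R)`: the `L^p`
norm of `v⁻¹ / (κ R + |x₀ - ·|) ^ e`. -/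
noncomputable def weightNorm {n : ℕ} (v : Rn n → ℝ) (p : ℝ≥0∞) (κ e : ℝ) (x₀ : Rn n) (R : ℝ) :
    ℝ≥0∞ :=
  eLpNorm (fun y => (v y)⁻¹ / (κ * R + ‖x₀ - y‖) ^ e) p volume

theorem IsWeight.aestronglyMeasurable_inv {n : ℕ} {v : Rn n → ℝ} (hv : IsWeight v) :
    AEStronglyMeasurable (fun y => (v y)⁻¹) volume :=
  hv.1.aestronglyMeasurable.aemeasurable.inv.aestronglyMeasurable

theorem IsWeight.aestronglyMeasurable_inv_div {n : ℕ} {v : Rn n → ℝ} (hv : IsWeight v) (κ e : ℝ)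
    (x₀ : Rn n) (R : ℝ) :
    AEStronglyMeasurable (fun y => (v y)⁻¹ / (κ * R + ‖x₀ - y‖) ^ e) volume := by
  have : Measurable fun y : Rn n => (κ * R + ‖x₀ - y‖) ^ e := by fun_prop
  exact (hv.aestronglyMeasurable_inv.aemeasurable.div this.aemeasurable).aestronglyMeasurable

theorem eLpNorm_inv_restrict_ball_le {n : ℕ} (v : Rn n → ℝ) (p : ℝ≥0∞) {κ e : ℝ} (hκ : 0 < κ)
    (he : 0 ≤ e) (x₀ : Rn n) {R : ℝ} (hR : 0 < R) :
    eLpNorm (fun y => (v y)⁻¹) p (volume.restrict (Metric.ball x₀ (2 * R))) ≤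
      ENNReal.ofReal ((κ + 2) ^ e) * (ENNReal.ofReal R ^ e * weightNorm v p κ e x₀ R) := by
  have h : ∀ᵐ y ∂volume.restrict (Metric.ball x₀ (2 * R)), ‖(v y)⁻¹‖ ≤
      ((κ + 2) * R) ^ e * ‖(v y)⁻¹ / (κ * R + ‖x₀ - y‖) ^ e‖ := by
    filter_upwards [ae_restrict_mem Metric.isOpen_ball.measurableSet] with y hy
    have hy' : ‖x₀ - y‖ < 2 * R := by
      rw [← dist_eq_norm, dist_comm]; exact hy
    have hpos : 0 < κ * R + ‖x₀ - y‖ := by positivity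
    have hle : (κ * R + ‖x₀ - y‖) ^ e ≤ ((κ + 2) * R) ^ e :=
      Real.rpow_le_rpow hpos.le (by linarith) he
    have hpos' := Real.rpow_pos_of_pos hpos e
    rw [norm_div, Real.norm_of_nonneg hpos'.le, ← mul_div_assoc, le_div_iff₀ hpos', mul_comm]
    gcongr
  refine (eLpNorm_le_mul_eLpNorm_of_ae_le_mul h p).trans ?_
  rw [Real.mul_rpow (by positivity) hR.le, ENNReal.ofReal_mul (by positivity), mul_assoc,
    ENNReal.ofReal_rpow_of_pos hR]
  gcongr
  exact eLpNorm_restrict_le _ _ _ _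

/-- The reverse Hölder inequality in terms of norms. For `p = 1` both exponents are infinite. -/
theorem exists_eLpNorm_inv_reverseHolder {n m : ℕ} (hm : 0 < m) {p : ℝ≥0∞} (hp : 1 ≤ p)
    {v : Rn n → ℝ} (hv : IsWeight v)
    (hRH : 1 < p → MemRH m (fun x => v x ^ (-p.conjExponent.toReal))) :
    ∃ C : ℝ≥0, ∀ (x₀ : Rn n) (R : ℝ), 0 < R →
      eLpNorm (fun y => (v y)⁻¹) (m * p.conjExponent) (volume.restrict (Metric.ball x₀ R)) ≤
        C * (volume (Metric.ball x₀ R) ^ ((1 / (m : ℝ) - 1) * (1 - p⁻¹.toReal)) *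
          eLpNorm (fun y => (v y)⁻¹) p.conjExponent (volume.restrict (Metric.ball x₀ R))) := by
  have hm' : (0 : ℝ) < m := by exact_mod_cast hm
  have hconj := ENNReal.HolderConjugate.conjExponent hp
  have hinv := hconj.inv_add_inv_eq_inv
  rw [inv_one] at hinv
  rcases hp.eq_or_lt with rfl | hp1
  · refine ⟨1, fun x₀ R hR => ?_⟩
    have : ENNReal.conjExponent 1 = ∞ := by simp [ENNReal.conjExponent]
    rw [this, ENNReal.mul_top (by exact_mod_cast hm.ne')]
    simp
  obtain ⟨-, C, hC⟩ := hRH hp1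
  set P := p.conjExponent with hP
  have hP1 : 1 ≤ P := by rw [hP, ENNReal.conjExponent]; exact le_self_add
  have hPt : P ≠ ∞ := by
    intro h
    rw [h, ENNReal.inv_top, add_zero, ENNReal.inv_eq_one] at hinv
    exact hp1.ne' hinv
  have hP0 : P ≠ 0 := (zero_lt_one.trans_le hP1).ne'
  set r := P.toReal with hr
  have hr0 : 0 < r := ENNReal.toReal_pos hP0 hPt
  have hθ : 1 - p⁻¹.toReal = 1 / r := by
    have := congrArg ENNReal.toReal hinv
    rw [ENNReal.toReal_add (by simpa using (zero_lt_one.trans hp1).ne') (by simpa using hP0),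
      ENNReal.toReal_inv P, ENNReal.toReal_one] at this
    rw [one_div]; linarith
  refine ⟨C ^ (1 / r), fun x₀ R hR => ?_⟩
  have h := hC x₀ R hR
  set V := volume (Metric.ball x₀ R) with hV
  have hV0 : V ≠ 0 := (Metric.measure_ball_pos _ _ hR).ne'
  have hVt : V ≠ ∞ := measure_ball_lt_top.ne
  have e₁ : ∀ᵐ y ∂volume.restrict (Metric.ball x₀ R),
      ENNReal.ofReal (v y ^ (-r)) = ‖(v y)⁻¹‖ₑ ^ r := by
    filter_upwards [ae_restrict_of_ae hv.2] with y hy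
    rw [Real.enorm_eq_ofReal (by positivity), ENNReal.ofReal_rpow_of_nonneg (by positivity) hr0.le,
      Real.inv_rpow hy.le, Real.rpow_neg hy.le]
  have e₂ : ∫⁻ y in Metric.ball x₀ R, ENNReal.ofReal (v y ^ (-r)) =
      ∫⁻ y in Metric.ball x₀ R, ‖(v y)⁻¹‖ₑ ^ r := lintegral_congr_ae e₁
  have e₃ : ∫⁻ y in Metric.ball x₀ R, ENNReal.ofReal (v y ^ (-r)) ^ (m : ℝ) =
      ∫⁻ y in Metric.ball x₀ R, ‖(v y)⁻¹‖ₑ ^ (m * r) := by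
    refine lintegral_congr_ae (e₁.mono fun y hy => ?_)
    simp only
    rw [hy, ← ENNReal.rpow_mul, mul_comm]
  rw [e₂, e₃] at h
  rw [eLpNorm_eq_lintegral_rpow_enorm_toReal hP0 hPt, eLpNorm_eq_lintegral_rpow_enorm_toReal
    (mul_ne_zero (by exact_mod_cast hm.ne') hP0) (ENNReal.mul_ne_top (by simp) hPt),
    ENNReal.toReal_mul, ENNReal.toReal_natCast, ← hr, hθ]
  set X := ∫⁻ y in Metric.ball x₀ R, ‖(v y)⁻¹‖ₑ ^ (m * r)
  set Y := ∫⁻ y in Metric.ball x₀ R, ‖(v y)⁻¹‖ₑ ^ r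
  have h1 : X ^ (1 / (m : ℝ)) ≤ C * (V ^ (1 / (m : ℝ) - 1) * Y) := by
    calc X ^ (1 / (m : ℝ)) = (X / V) ^ (1 / (m : ℝ)) * V ^ (1 / (m : ℝ)) := by
          rw [← ENNReal.mul_rpow_of_nonneg _ _ (by positivity), ENNReal.div_mul_cancel hV0 hVt]
      _ ≤ C * (Y / V) * V ^ (1 / (m : ℝ)) := by gcongr
      _ = _ := by
          rw [sub_eq_add_neg, ENNReal.rpow_add _ _ hV0 hVt, ENNReal.rpow_neg_one,
            ENNReal.div_eq_inv_mul]
          ring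
  calc X ^ (1 / (m * r)) = (X ^ (1 / (m : ℝ))) ^ (1 / r) := by
        rw [← ENNReal.rpow_mul]; congr 1; field_simp
    _ ≤ (C * (V ^ (1 / (m : ℝ) - 1) * Y)) ^ (1 / r) := by gcongr
    _ = _ := by
        rw [ENNReal.mul_rpow_of_nonneg _ _ (by positivity),
          ENNReal.mul_rpow_of_nonneg _ _ (by positivity), ← ENNReal.rpow_mul,
          ENNReal.coe_rpow_of_nonneg _ (by positivity)]

section Local

variable {𝕜 : Type*} [RCLike 𝕜] {n m : ℕ}

theorem ae_eq_inv_smul_smul {v : Rn n → ℝ} (hv : IsWeight v) (f : Rn n → 𝕜) :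
    f =ᵐ[volume] (fun y => (v y)⁻¹) • fun y => v y • f y := by
  filter_upwards [hv.2] with y hy
  simp [smul_smul, inv_mul_cancel₀ hy.ne']

theorem aestronglyMeasurable_of_smul {v : Rn n → ℝ} (hv : IsWeight v) {f : Rn n → 𝕜}
    (hf : AEStronglyMeasurable (fun y => v y • f y) volume) : AEStronglyMeasurable f volume :=
  (hv.aestronglyMeasurable_inv.smul hf).congr (ae_eq_inv_smul_smul hv f).symm

/-- The reverse Hölder condition improves the local integrability of `f` from `L^1` to `L^q`, where
`1 / q = 1 / m + (1 - 1 / m) / p`. -/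
theorem exists_lintegral_ball_rpow_le (hn : 0 < n) (hm : 0 < m) {p : ℝ≥0∞} (hp : 1 ≤ p)
    {v : Rn n → ℝ} (hv : IsWeight v)
    (hRH : 1 < p → MemRH m (fun x => v x ^ (-p.conjExponent.toReal))) {κ e : ℝ} (hκ : 0 < κ)
    (he : 0 ≤ e) {q : ℝ} (hq : 1 / q = 1 / m + (1 - 1 / m) * p⁻¹.toReal) :
    ∃ C : ℝ≥0, ∀ (f : Rn n → 𝕜), AEStronglyMeasurable (fun y => v y • f y) volume →
      ∀ (x₀ : Rn n) (R : ℝ), 0 < R →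
      (∫⁻ y in Metric.ball x₀ (2 * R), ‖f y‖ₑ ^ q) ^ (1 / q) ≤
        C * (ENNReal.ofReal R ^ (n * ((1 / (m : ℝ) - 1) * (1 - p⁻¹.toReal)) + e) *
          (eLpNorm (fun y => v y • f y) p volume * weightNorm v p.conjExponent κ e x₀ R)) := by
  obtain ⟨C, hC⟩ := exists_eLpNorm_inv_reverseHolder hm hp hv hRH
  have hconj := ENNReal.HolderConjugate.conjExponent hp
  have hinv := hconj.inv_add_inv_eq_inv
  rw [inv_one] at hinv
  have hm' : (0 : ℝ) < m := by exact_mod_cast hm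
  have hmt : (m : ℝ≥0∞) ≠ 0 := by exact_mod_cast hm.ne'
  set P := p.conjExponent with hP
  have hP1 : 1 ≤ P := by rw [hP, ENNReal.conjExponent]; exact le_self_add
  have hP0 : P ≠ 0 := (zero_lt_one.trans_le hP1).ne'
  have hp0 : p ≠ 0 := (zero_lt_one.trans_le hp).ne'
  set θ := p⁻¹.toReal with hθ
  have hθ' : P⁻¹.toReal = 1 - θ := by
    have := congrArg ENNReal.toReal hinv
    rw [ENNReal.toReal_add (by simpa using hp0) (by simpa using hP0), ENNReal.toReal_one] at this
    linarith
  have hθ1 : θ ≤ 1 := by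
    have := ENNReal.toReal_nonneg (a := P⁻¹)
    linarith
  set q' : ℝ≥0∞ := ((m * P)⁻¹ + p⁻¹)⁻¹ with hq'
  have hT : ENNReal.HolderTriple (m * P) p q' := .of _ _
  have hsum : ((m * P)⁻¹ + p⁻¹).toReal = 1 / q := by
    rw [ENNReal.toReal_add (by simp [hP0, hmt]) (by simpa using hp0),
      ENNReal.mul_inv (Or.inl hmt) (Or.inr hP0), ENNReal.toReal_mul, hθ', hq,
      ENNReal.toReal_inv]
    simp only [ENNReal.toReal_natCast]
    field_simp
    ring
  have hqpos : 0 < 1 / q := by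
    rw [hq]
    have h1 : (1 : ℝ) / m ≤ 1 := by
      rw [div_le_one hm']; exact_mod_cast hm
    have : 0 ≤ (1 - 1 / (m : ℝ)) * θ := mul_nonneg (by linarith) ENNReal.toReal_nonneg
    positivity
  have hqr : q'.toReal = q := by
    rw [hq', ENNReal.toReal_inv, hsum]; simp
  have hq0 : 0 < q := by simpa using hqpos
  have hq'0 : q' ≠ 0 := fun h => by rw [h] at hqr; simp at hqr; linarith
  have hq't : q' ≠ ∞ := fun h => by rw [h] at hqr; simp at hqr; linarith
  set t : ℝ := (1 / (m : ℝ) - 1) * (1 - θ) with ht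
  set ω := volume (Metric.ball (0 : Rn n) 1) with hω
  have hω0 : ω ≠ 0 := (Metric.measure_ball_pos _ _ one_pos).ne'
  have hωt : ω ≠ ∞ := measure_ball_lt_top.ne
  have hCt : (C : ℝ≥0∞) *
      ((ENNReal.ofReal 2 ^ (n : ℝ) * ω) ^ t * ENNReal.ofReal ((κ + 2) ^ e)) ≠ ∞ := by
    refine ENNReal.mul_ne_top (by simp) (ENNReal.mul_ne_top ?_ (by simp))
    refine ENNReal.rpow_ne_top_of_ne_zero (mul_ne_zero (by simp) hω0) (ENNReal.mul_ne_top ?_ hωt)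
    exact ENNReal.rpow_ne_top_of_nonneg (by positivity) (by simp)
  refine ⟨((C : ℝ≥0∞) *
    ((ENNReal.ofReal 2 ^ (n : ℝ) * ω) ^ t * ENNReal.ofReal ((κ + 2) ^ e))).toNNReal,
    fun f hf x₀ R hR => ?_⟩
  rw [ENNReal.coe_toNNReal hCt]
  have hR2 : 0 < 2 * R := by positivity
  have hR0 : ENNReal.ofReal R ≠ 0 := by simpa using hR
  have e₁ : (∫⁻ y in Metric.ball x₀ (2 * R), ‖f y‖ₑ ^ q) ^ (1 / q) =
      eLpNorm f q' (volume.restrict (Metric.ball x₀ (2 * R))) := by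
    rw [eLpNorm_eq_lintegral_rpow_enorm_toReal hq'0 hq't, hqr]
  have eV : volume (Metric.ball x₀ (2 * R)) ^ t =
      (ENNReal.ofReal 2 ^ (n : ℝ) * ω) ^ t * ENNReal.ofReal R ^ (n * t) := by
    rw [volume_ball_eq hn x₀ hR2, ENNReal.ofReal_mul (by norm_num),
      ENNReal.mul_rpow_of_nonneg _ _ (Nat.cast_nonneg n), ← hω, mul_right_comm,
      ENNReal.mul_rpow_of_ne_top (ENNReal.mul_ne_top
        (ENNReal.rpow_ne_top_of_nonneg (by positivity) (by simp)) hωt)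
        (ENNReal.rpow_ne_top_of_nonneg (by positivity) (by simp)), ← ENNReal.rpow_mul]
  calc _ = eLpNorm ((fun y => (v y)⁻¹) • fun y => v y • f y) q'
        (volume.restrict (Metric.ball x₀ (2 * R))) := by
        rw [e₁]; exact eLpNorm_congr_ae (ae_restrict_of_ae (ae_eq_inv_smul_smul hv f))
    _ ≤ eLpNorm (fun y => (v y)⁻¹) (m * P) (volume.restrict (Metric.ball x₀ (2 * R))) *
        eLpNorm (fun y => v y • f y) p (volume.restrict (Metric.ball x₀ (2 * R))) :=
        eLpNorm_smul_le_mul_eLpNorm hf.restrict hv.aestronglyMeasurable_inv.restrict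
    _ ≤ (C * (volume (Metric.ball x₀ (2 * R)) ^ t * (ENNReal.ofReal ((κ + 2) ^ e) *
          (ENNReal.ofReal R ^ e * weightNorm v P κ e x₀ R)))) *
        eLpNorm (fun y => v y • f y) p volume := by
        gcongr
        · refine (hC x₀ _ hR2).trans ?_
          gcongr
          exact eLpNorm_inv_restrict_ball_le v P hκ he x₀ hR
        · exact Measure.restrict_le_self
    _ = _ := by
        rw [eV, ENNReal.rpow_add _ _ hR0 ENNReal.ofReal_ne_top]
        ring

/-- Fractional integration over `B(x₀, 2R)`, from `L^q` to `L^m(B(x₀, R))`. -/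
theorem exists_fractional_ball_le (hm : 0 < m) {θ β q : ℝ} (hθ0 : 0 ≤ θ) (hθ1 : θ ≤ 1)
    (hβ : n * (1 - 1 / (m : ℝ)) * θ < β) (hq : 1 / q = 1 / m + (1 - 1 / m) * θ) (hn : 0 < n) :
    ∃ C : ℝ≥0, ∀ (g : Rn n → ℝ≥0∞), AEMeasurable g volume → ∀ (x₀ : Rn n) (R : ℝ), 0 < R →
      (∫⁻ x in Metric.ball x₀ R,
          (∫⁻ y in Metric.ball x₀ (2 * R), ‖x - y‖ₑ ^ (β - n) * g y) ^ (m : ℝ)) ^ (1 / (m : ℝ)) ≤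
        C * (ENNReal.ofReal R ^ (β - n * (1 - 1 / (m : ℝ)) * θ) *
          (∫⁻ y in Metric.ball x₀ (2 * R), g y ^ q) ^ (1 / q)) := by
  have hm' : (0 : ℝ) < m := by exact_mod_cast hm
  have hn' : (0 : ℝ) < n := by exact_mod_cast hn
  have hm1 : (0 : ℝ) ≤ 1 - 1 / m := by
    rw [sub_nonneg, div_le_one hm']; exact_mod_cast hm
  have hmθ : (1 - 1 / (m : ℝ)) * θ ≤ 1 - 1 / m := mul_le_of_le_one_right hm1 hθ1
  have hmθ0 : 0 ≤ (1 - 1 / (m : ℝ)) * θ := mul_nonneg hm1 hθ0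
  have hm0 : (0 : ℝ) < 1 / m := by positivity
  set s : ℝ := (1 - (1 - 1 / (m : ℝ)) * θ)⁻¹ with hs
  have hs0 : 0 < s := inv_pos.2 (by linarith)
  have hs1 : 1 / s = 1 - (1 - 1 / (m : ℝ)) * θ := by rw [hs, one_div, inv_inv]
  have hq0 : 0 < q := by
    have : 0 < 1 / q := by rw [hq]; linarith
    simpa using this
  have ht : -(n : ℝ) < (β - n) * s := by
    have : 0 < (1 / s * n + (β - n)) * s := by
      refine mul_pos ?_ hs0
      rw [hs1]; nlinarith
    have e : (1 / s * n + (β - n)) * s = n + (β - n) * s := by field_simp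
    linarith
  set J := ∫⁻ z in Metric.ball (0 : Rn n) 1, ‖z‖ₑ ^ ((β - n) * s) with hJ
  have hJt : J ≠ ∞ := (lintegral_unitBall_enorm_rpow_lt_top hn ht).ne
  set a : ℝ := (n + (β - n) * s) * (1 / s) with ha
  have ha' : a = β - n * (1 - 1 / (m : ℝ)) * θ := by
    have : a = n * (1 / s) + (β - n) := by rw [ha]; field_simp
    rw [this, hs1]; ring
  have ha0 : 0 < a := mul_pos (by linarith) (by positivity)
  have hCt : ENNReal.ofReal 3 ^ a * J ^ (1 / s) ≠ ∞ :=
    ENNReal.mul_ne_top (ENNReal.rpow_ne_top_of_nonneg ha0.le (by simp))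
      (ENNReal.rpow_ne_top_of_nonneg (by positivity) hJt)
  refine ⟨(ENNReal.ofReal 3 ^ a * J ^ (1 / s)).toNNReal, fun g hg x₀ R hR => ?_⟩
  rw [ENNReal.coe_toNNReal hCt]
  have hk : Measurable (Function.uncurry fun x y : Rn n => ‖x - y‖ₑ ^ (β - n)) :=
    ((measurable_fst.sub measurable_snd).enorm).pow_const _
  have key := lintegral_kernel_rpow_le (μ := volume.restrict (Metric.ball x₀ R))
    (ν := volume.restrict (Metric.ball x₀ (2 * R))) hk hg.restrict hm' hs0 hq0
    (M := ENNReal.ofReal (3 * R) ^ (n + (β - n) * s) * J)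
    ((one_div_le_one_div hm' hs0).1 (by rw [hs1]; linarith))
    ((one_div_le_one_div hm' hq0).1 (by rw [hq]; linarith))
    (by rw [hs1, hq]; ring)
    (by
      filter_upwards [ae_restrict_mem Metric.isOpen_ball.measurableSet] with x hx
      simp only [← ENNReal.rpow_mul]
      refine lintegral_ball_enorm_sub_rpow_le _ (by positivity) fun y hy => ?_
      rw [← dist_eq_norm]
      have := dist_triangle_right x y x₀
      rw [Metric.mem_ball] at hx hy
      linarith)
    (by
      filter_upwards [ae_restrict_mem Metric.isOpen_ball.measurableSet] with x hx
      simp only [← ENNReal.rpow_mul, enorm_sub_rev _ x]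
      refine lintegral_ball_enorm_sub_rpow_le _ (by positivity) fun y hy => ?_
      rw [← dist_eq_norm]
      have := dist_triangle_right x y x₀
      rw [Metric.mem_ball] at hx hy
      linarith)
  refine key.trans (le_of_eq ?_)
  rw [ENNReal.mul_rpow_of_nonneg _ _ (by positivity), ← ENNReal.rpow_mul, ← ha,
    ENNReal.ofReal_mul (by norm_num), ENNReal.mul_rpow_of_nonneg _ _ ha0.le, ← ha']
  ring

/-- Hölder's inequality against the weight of the class `ℋ_m`. -/
theorem lintegral_div_le_weightNorm {p : ℝ≥0∞} (hp : 1 ≤ p) {v : Rn n → ℝ} (hv : IsWeight v)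
    {f : Rn n → 𝕜} (hf : AEStronglyMeasurable (fun y => v y • f y) volume) {κ : ℝ} (hκ : 0 < κ)
    (e : ℝ) (x₀ : Rn n) {R : ℝ} (hR : 0 < R) :
    ∫⁻ y, ‖f y‖ₑ * ENNReal.ofReal ((κ * R + ‖x₀ - y‖) ^ (-e)) ≤
      eLpNorm (fun y => v y • f y) p volume * weightNorm v p.conjExponent κ e x₀ R := by
  have hconj := (ENNReal.HolderConjugate.conjExponent hp).symm
  have hmeas := hv.aestronglyMeasurable_inv_div κ e x₀ R
  have H := eLpNorm_smul_le_mul_eLpNorm (p := p.conjExponent) (q := p) (r := 1) hf hmeas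
  refine (le_of_eq ?_).trans (H.trans_eq (mul_comm _ _))
  rw [eLpNorm_one_eq_lintegral_enorm]
  refine lintegral_congr_ae ?_
  filter_upwards [hv.2] with y hy
  have hpos : 0 < κ * R + ‖x₀ - y‖ := by positivity
  rw [Pi.smul_apply', smul_smul, enorm_smul, mul_comm, div_mul_eq_mul_div,
    inv_mul_cancel₀ hy.ne', Real.enorm_eq_ofReal (by positivity), Real.rpow_neg hpos.le, one_div]

end Local

/-! ### Pointwise bounds for the kernel -/

section Pointwise

variable {𝕜 : Type*} [RCLike 𝕜] {n m : ℕ}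

theorem norm_sub_le_sumDist (x : Rn n) (y : Fin m → Rn n) (i : Fin m) :
    ‖x - y i‖ ≤ sumDist x y :=
  Finset.single_le_sum (f := fun i => ‖x - y i‖) (fun _ _ => norm_nonneg _) (Finset.mem_univ i)

theorem sumDist_nonneg (x : Rn n) (y : Fin m → Rn n) : 0 ≤ sumDist x y :=
  Finset.sum_nonneg fun _ _ => norm_nonneg _

theorem sumDist_le_add (x z : Rn n) (y : Fin m → Rn n) :
    sumDist x y ≤ sumDist z y + m * ‖x - z‖ := by
  have h : ∀ i ∈ Finset.univ, ‖x - y i‖ ≤ ‖z - y i‖ + ‖x - z‖ := fun i _ => by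
    have := norm_sub_le_norm_sub_add_norm_sub x z (y i)
    linarith
  refine (Finset.sum_le_sum h).trans (le_of_eq ?_)
  simp [Finset.sum_add_distrib, sumDist]

theorem IsFractionalKernel.exists_norm_le {α γ : ℝ} {K : Rn n → (Fin m → Rn n) → 𝕜}
    (hK : IsFractionalKernel α γ K) :
    ∃ A : ℝ, 0 ≤ A ∧ ∀ x y, 0 < sumDist x y →
      ‖K x y‖ ≤ A * sumDist x y ^ (-((m : ℝ) * n - α)) := by
  obtain ⟨A, hA⟩ := hK.size
  refine ⟨|A|, abs_nonneg A, fun x y h => (hA x y h).trans ?_⟩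
  rw [Real.rpow_neg h.le, ← div_eq_mul_inv]
  gcongr
  exact le_abs_self A

theorem MemLambda.exists_norm_sub_le {δ : ℝ} {b : Rn n → 𝕜} (hb : MemLambda δ b) :
    ∃ D : ℝ, 0 ≤ D ∧ ∀ x y, ‖b x - b y‖ ≤ D * ‖x - y‖ ^ δ := by
  obtain ⟨D, hD⟩ := hb
  refine ⟨|D|, abs_nonneg D, fun x y => (hD x y).trans ?_⟩
  gcongr
  exact le_abs_self D

theorem MemLambda.continuous {δ : ℝ} (hδ : 0 < δ) {b : Rn n → 𝕜} (hb : MemLambda δ b) :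
    Continuous b := by
  obtain ⟨D, -, hD⟩ := hb.exists_norm_sub_le
  refine continuous_iff_continuousAt.2 fun z => ?_
  refine tendsto_iff_norm_sub_tendsto_zero.2 (squeeze_zero (fun _ => norm_nonneg _)
    (fun x => hD x z) ?_)
  have h : Continuous fun x : Rn n => D * ‖x - z‖ ^ δ :=
    continuous_const.mul ((continuous_id.sub continuous_const).norm.rpow_const
      fun _ => Or.inr hδ.le)
  have h' := h.tendsto z
  simpa [Real.zero_rpow hδ.ne'] using h'

/-- The factor `b x - b (y j)` raises the order of the kernel from `α` to `α + δ`; the resulting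
multilinear fractional kernel is dominated by a product of linear ones. -/
theorem exists_enorm_sub_mul_kernel_le {α γ δ : ℝ} (hδ : 0 < δ)
    {K : Rn n → (Fin m → Rn n) → 𝕜} (hK : IsFractionalKernel α γ K) {b : Rn n → 𝕜}
    (hb : MemLambda δ b) (j : Fin m) {β : Fin m → ℝ} (hβ : ∀ i, β i ≤ n)
    (hsum : ∑ i, β i = α + δ) :
    ∃ C : ℝ≥0, ∀ x y, ‖(b x - b (y j)) * K x y‖ₑ ≤ C * ∏ i, ‖x - y i‖ₑ ^ (β i - n) := by
  obtain ⟨A, hA0, hA⟩ := hK.exists_norm_le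
  obtain ⟨D, hD0, hD⟩ := hb.exists_norm_sub_le
  refine ⟨Real.toNNReal (D * A), fun x y => ?_⟩
  rcases (sumDist_nonneg x y).eq_or_lt with h0 | hpos
  · -- at the singular point the factor `b x - b (y j)` vanishes, whatever the kernel is
    have h1 := norm_sub_le_sumDist x y j
    rw [← h0, norm_le_zero_iff, sub_eq_zero] at h1
    rw [← h1]
    simp
  set S := sumDist x y with hS
  have hexp : δ + -((m : ℝ) * n - α) = ∑ i, (β i - n) := by
    rw [Finset.sum_sub_distrib, hsum]; simp; ring
  have h1 : ‖(b x - b (y j)) * K x y‖ ≤ D * A * ∏ i, S ^ (β i - n) := by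
    rw [norm_mul, ← Real.rpow_sum_of_pos hpos, ← hexp, Real.rpow_add hpos]
    calc ‖b x - b (y j)‖ * ‖K x y‖ ≤ (D * S ^ δ) * (A * S ^ (-((m : ℝ) * n - α))) := by
          refine mul_le_mul ((hD _ _).trans ?_) (hA x y hpos) (norm_nonneg _) (by positivity)
          have := norm_sub_le_sumDist x y j
          gcongr
      _ = _ := by ring
  rw [← ofReal_norm]
  refine (ENNReal.ofReal_le_ofReal h1).trans ?_
  rw [ENNReal.ofReal_mul (by positivity), ENNReal.ofReal_prod_of_nonneg
    (fun i _ => by positivity)]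
  refine mul_le_mul' le_rfl (Finset.prod_le_prod' fun i _ => ?_)
  rw [← ENNReal.ofReal_rpow_of_pos hpos, ← ofReal_norm, ← neg_sub, ENNReal.rpow_neg,
    ENNReal.rpow_neg, ENNReal.inv_le_inv]
  exact ENNReal.rpow_le_rpow (ENNReal.ofReal_le_ofReal (norm_sub_le_sumDist x y i))
    (by linarith [hβ i])

/-- A point outside `B(x₀, 2R)` is seen from `B(x₀, R)` as it is from the centre. -/
theorem sumDist_far {x₀ : Rn n} {κ R : ℝ} (hκ : 0 < κ) {y : Fin m → Rn n} {i₀ : Fin m}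
    (hi₀ : 2 * R ≤ dist (y i₀) x₀) {u : Rn n} (hu : dist u x₀ < R) :
    R ≤ sumDist u y ∧
      ∑ i, (κ * R + ‖x₀ - y i‖) ≤ (m * κ + m + 1) * sumDist u y := by
  have h1 : R ≤ sumDist u y := by
    refine le_trans ?_ (norm_sub_le_sumDist u y i₀)
    rw [← dist_eq_norm]
    have := dist_triangle_left (y i₀) x₀ u
    linarith
  have h2 := sumDist_le_add x₀ u y
  rw [← dist_eq_norm, dist_comm] at h2
  refine ⟨h1, ?_⟩
  have hE : ∑ i, (κ * R + ‖x₀ - y i‖) = m * (κ * R) + sumDist x₀ y := by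
    simp [sumDist, Finset.sum_add_distrib]
  have hm : (0 : ℝ) ≤ m := Nat.cast_nonneg m
  rw [hE]
  nlinarith [mul_le_mul_of_nonneg_left h1 (mul_nonneg hm hκ.le),
    mul_le_mul_of_nonneg_left (hu.le.trans h1) hm]

theorem rpow_neg_le_mul_rpow_neg {L s E μ : ℝ} (hL : 0 < L) (hs : 0 < s) (hE : 0 < E)
    (h : E ≤ L * s) (hμ : 0 ≤ μ) : s ^ (-μ) ≤ L ^ μ * E ^ (-μ) := by
  have h1 : (L * s) ^ (-μ) ≤ E ^ (-μ) := Real.rpow_le_rpow_of_nonpos hE h (by linarith)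
  calc s ^ (-μ) = L ^ μ * (L * s) ^ (-μ) := by
        rw [Real.mul_rpow hL.le hs.le, ← mul_assoc, ← Real.rpow_add hL, add_neg_cancel,
          Real.rpow_zero, one_mul]
    _ ≤ L ^ μ * E ^ (-μ) := mul_le_mul_of_nonneg_left h1 (by positivity)

/-- The surplus `γ - δ` of smoothness is spent on a distance `S` that is at least `R`. -/
theorem smooth_term_le {D A a R S T L δ γ μ : ℝ} (hD : 0 ≤ D) (hA : 0 ≤ A) (ha : 0 ≤ a)
    (hR : 0 < R) (hS : R ≤ S) (hδγ : δ < γ) (hT : S ^ (-μ) ≤ L * T) :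
    (D * (a * S) ^ δ) * (A * (2 * R) ^ γ * S ^ (-(μ + γ))) ≤
      D * a ^ δ * (A * 2 ^ γ * L) * (R ^ δ * T) := by
  have hS0 : 0 < S := hR.trans_le hS
  have hexp : S ^ δ * S ^ (-(μ + γ)) = S ^ (δ - γ) * S ^ (-μ) := by
    rw [← Real.rpow_add hS0, ← Real.rpow_add hS0]; congr 1; ring
  have hSγ : R ^ γ * S ^ (δ - γ) ≤ R ^ δ := by
    calc R ^ γ * S ^ (δ - γ) ≤ R ^ γ * R ^ (δ - γ) :=
          mul_le_mul_of_nonneg_left (Real.rpow_le_rpow_of_nonpos hR hS (by linarith))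
            (by positivity)
      _ = R ^ δ := by rw [← Real.rpow_add hR]; congr 1; ring
  calc (D * (a * S) ^ δ) * (A * (2 * R) ^ γ * S ^ (-(μ + γ)))
      = D * a ^ δ * (A * 2 ^ γ) * (R ^ γ * (S ^ δ * S ^ (-(μ + γ)))) := by
        rw [Real.mul_rpow ha hS0.le, Real.mul_rpow (by norm_num) hR.le]; ring
    _ = D * a ^ δ * (A * 2 ^ γ) * ((R ^ γ * S ^ (δ - γ)) * S ^ (-μ)) := by rw [hexp]; ring
    _ ≤ D * a ^ δ * (A * 2 ^ γ) * (R ^ δ * (L * T)) := by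
        have h := mul_le_mul hSγ hT (by positivity) (by positivity)
        exact mul_le_mul_of_nonneg_left h (by positivity)
    _ = _ := by ring

theorem sum_rpow_neg_le_prod {E : Fin m → ℝ} (hE : ∀ i, 0 < E i) (hsum : 0 < ∑ i, E i)
    {e : Fin m → ℝ} (he : ∀ i, 0 ≤ e i) : (∑ i, E i) ^ (-∑ i, e i) ≤ ∏ i, E i ^ (-e i) := by
  rw [← Finset.sum_neg_distrib, Real.rpow_sum_of_pos hsum]
  refine Finset.prod_le_prod (fun i _ => Real.rpow_nonneg hsum.le _) fun i _ => ?_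
  exact Real.rpow_le_rpow_of_nonpos (hE i)
    (Finset.single_le_sum (fun i _ => (hE i).le) (Finset.mem_univ i)) (by linarith [he i])

/-- Away from the diagonal the increment of the kernel of the commutator between two points of a
ball is of size `R ^ δ` times the fractional kernel of order `α`, seen from the centre. -/
theorem exists_norm_increment_le {α γ δ : ℝ} (hα : α < (m : ℝ) * n) (hδ : 0 < δ) (hδγ : δ < γ)
    {K : Rn n → (Fin m → Rn n) → 𝕜} (hK : IsFractionalKernel α γ K) {b : Rn n → 𝕜}
    (hb : MemLambda δ b) (j : Fin m) {κ : ℝ} (hκ : 0 < κ) {e : Fin m → ℝ} (he : ∀ i, 0 ≤ e i)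
    (hsum : ∑ i, e i = (m : ℝ) * n - α) :
    ∃ C : ℝ, 0 ≤ C ∧ ∀ (x₀ : Rn n) (R : ℝ), 0 < R → ∀ x ∈ Metric.ball x₀ R,
      ∀ z ∈ Metric.ball x₀ R, ∀ y : Fin m → Rn n, (∃ i, y i ∉ Metric.ball x₀ (2 * R)) →
      ‖(b x - b (y j)) * K x y - (b z - b (y j)) * K z y‖ ≤
        C * (R ^ δ * ∏ i, (κ * R + ‖x₀ - y i‖) ^ (-e i)) := by
  obtain ⟨A, hA0, hA⟩ := hK.exists_norm_le
  obtain ⟨D, hD0, hD⟩ := hb.exists_norm_sub_le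
  obtain ⟨c, A₂, hc, hA₂⟩ := hK.smooth
  set μ : ℝ := (m : ℝ) * n - α with hμ
  have hμ0 : 0 < μ := by rw [hμ]; linarith
  set L : ℝ := m * κ + m + 1 with hL
  have hL0 : 0 < L := by positivity
  refine ⟨D * 2 ^ δ * (A * L ^ μ) + (D * (1 + 2 * m) ^ δ * (|A₂| * 2 ^ γ * L ^ μ) +
    D * ((1 + 2 * m) * (2 * c)) ^ δ * (A * L ^ μ + A * L ^ μ)), by positivity, ?_⟩
  rintro x₀ R hR x hx z hz y ⟨i₀, hi₀⟩
  rw [Metric.mem_ball] at hx hz hi₀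
  have hi₀' : 2 * R ≤ dist (y i₀) x₀ := not_lt.1 hi₀
  have hm : (0 : ℝ) < m := by exact_mod_cast i₀.pos
  have hxz : ‖x - z‖ ≤ 2 * R := by
    rw [← dist_eq_norm]
    have := dist_triangle_right x z x₀
    linarith
  set E : ℝ := ∑ i, (κ * R + ‖x₀ - y i‖) with hE
  have hEpos : 0 < E :=
    Finset.sum_pos (fun i _ => by positivity) ⟨i₀, Finset.mem_univ _⟩
  -- both `x` and `z` see `y` at a distance comparable to `E`
  obtain ⟨hSR, hES⟩ := sumDist_far hκ hi₀' hx
  obtain ⟨hSR', hES'⟩ := sumDist_far hκ hi₀' hz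
  set S := sumDist x y with hS
  set S' := sumDist z y with hS'
  have hS0 : 0 < S := hR.trans_le hSR
  have hS0' : 0 < S' := hR.trans_le hSR'
  have hpow : ∀ s : ℝ, 0 < s → E ≤ L * s → s ^ (-μ) ≤ L ^ μ * E ^ (-μ) :=
    fun s hs h => rpow_neg_le_mul_rpow_neg hL0 hs hEpos h hμ0.le
  set T := E ^ (-μ) with hT
  have hT0 : 0 < T := Real.rpow_pos_of_pos hEpos _
  have hTle : T ≤ ∏ i, (κ * R + ‖x₀ - y i‖) ^ (-e i) := by
    rw [hT, hE, ← hsum]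
    exact sum_rpow_neg_le_prod (fun i => by positivity) hEpos he
  rw [← hE, ← hL] at hES hES'
  clear_value T E L μ
  have hγ0 : 0 ≤ γ := (hδ.trans hδγ).le
  have hKx : ‖K x y‖ ≤ A * L ^ μ * T := by
    refine (hA x y hS0).trans ?_
    rw [mul_assoc]
    exact mul_le_mul_of_nonneg_left (hpow S hS0 hES) hA0
  have hKz : ‖K z y‖ ≤ A * L ^ μ * T := by
    refine (hA z y hS0').trans ?_
    rw [mul_assoc]
    exact mul_le_mul_of_nonneg_left (hpow S' hS0' hES') hA0
  have hSS : S' ≤ (1 + 2 * m) * S := by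
    have h := sumDist_le_add z x y
    rw [norm_sub_rev] at h
    nlinarith
  have hbx : ‖b x - b z‖ ≤ D * 2 ^ δ * R ^ δ := by
    refine (hD x z).trans ?_
    rw [mul_assoc, ← Real.mul_rpow (by norm_num) hR.le]
    gcongr
  have hbz : ‖b z - b (y j)‖ ≤ D * ((1 + 2 * m) * S) ^ δ := by
    refine (hD z (y j)).trans ?_
    have := (norm_sub_le_sumDist z y j).trans hSS
    gcongr
  have hsecond : ‖b z - b (y j)‖ * ‖K x y - K z y‖ ≤
      (D * (1 + 2 * m) ^ δ * (|A₂| * 2 ^ γ * L ^ μ) +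
        D * ((1 + 2 * m) * (2 * c)) ^ δ * (A * L ^ μ + A * L ^ μ)) * (R ^ δ * T) := by
    rcases lt_or_ge (c * ‖x - z‖) S with hcS | hcS
    · have hdiff : ‖K x y - K z y‖ ≤ |A₂| * (2 * R) ^ γ * S ^ (-(μ + γ)) := by
        refine (hA₂ x z y hS0' hcS).trans ?_
        rw [Real.rpow_neg hS0.le, ← div_eq_mul_inv]
        gcongr
        exact le_abs_self A₂
      calc ‖b z - b (y j)‖ * ‖K x y - K z y‖
          ≤ (D * ((1 + 2 * m) * S) ^ δ) * (|A₂| * (2 * R) ^ γ * S ^ (-(μ + γ))) :=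
            mul_le_mul hbz hdiff (norm_nonneg _) (by positivity)
        _ ≤ (D * (1 + 2 * m) ^ δ * (|A₂| * 2 ^ γ * L ^ μ)) * (R ^ δ * T) :=
            smooth_term_le hD0 (abs_nonneg A₂) (by positivity) hR hSR hδγ (hpow S hS0 hES)
        _ ≤ _ := by
            refine mul_le_mul_of_nonneg_right ?_ (by positivity)
            exact le_add_of_nonneg_right (by positivity)
    -- here the smoothness condition is void, but `S` is comparable to `R` and size suffices
    · have hSc : S ≤ 2 * c * R := by nlinarith
      calc ‖b z - b (y j)‖ * ‖K x y - K z y‖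
          ≤ (D * ((1 + 2 * m) * (2 * c * R)) ^ δ) * (A * L ^ μ * T + A * L ^ μ * T) := by
            refine mul_le_mul (hbz.trans ?_) ((norm_sub_le _ _).trans (add_le_add hKx hKz))
              (norm_nonneg _) (by positivity)
            gcongr
        _ = (D * ((1 + 2 * m) * (2 * c)) ^ δ * (A * L ^ μ + A * L ^ μ)) * (R ^ δ * T) := by
            rw [← mul_assoc (1 + 2 * (m : ℝ)), Real.mul_rpow (by positivity) hR.le]; ring
        _ ≤ _ := by
            refine mul_le_mul_of_nonneg_right ?_ (by positivity)
            exact le_add_of_nonneg_left (by positivity)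
  have hid : (b x - b (y j)) * K x y - (b z - b (y j)) * K z y =
      (b x - b z) * K x y + (b z - b (y j)) * (K x y - K z y) := by ring
  calc ‖(b x - b (y j)) * K x y - (b z - b (y j)) * K z y‖
      ≤ ‖b x - b z‖ * ‖K x y‖ + ‖b z - b (y j)‖ * ‖K x y - K z y‖ := by
        rw [hid, ← norm_mul, ← norm_mul]; exact norm_add_le _ _
    _ ≤ (D * 2 ^ δ * R ^ δ) * (A * L ^ μ * T) + _ :=
        add_le_add (mul_le_mul hbx hKx (norm_nonneg _) (by positivity)) hsecond
    _ = (D * 2 ^ δ * (A * L ^ μ) + (D * (1 + 2 * m) ^ δ * (|A₂| * 2 ^ γ * L ^ μ) +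
          D * ((1 + 2 * m) * (2 * c)) ^ δ * (A * L ^ μ + A * L ^ μ))) * (R ^ δ * T) := by ring
    _ ≤ _ := by
        refine mul_le_mul_of_nonneg_left ?_ (by positivity)
        exact mul_le_mul_of_nonneg_left hTle (by positivity)

end Pointwise

/-! ### Oscillation of a function with controlled increments -/

/-- If `‖F x - F z‖ ≤ N x + N z + A` almost everywhere on a ball, then `F` is integrable there and
its mean oscillation is controlled by the mean of `N` and by `A`. -/
theorem integrableOn_and_lintegral_sub_average_le {𝕜 : Type*} [RCLike 𝕜] {n : ℕ} {F : Rn n → 𝕜}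
    (hF : AEStronglyMeasurable F volume) {x₀ : Rn n} {R : ℝ} (hR : 0 < R) {N : Rn n → ℝ≥0∞}
    (hN : AEMeasurable N (volume.restrict (Metric.ball x₀ R))) {A : ℝ≥0∞}
    (hNt : ∫⁻ x in Metric.ball x₀ R, N x ≠ ∞) (hA : A ≠ ∞)
    (h : ∀ᵐ z ∂volume.restrict (Metric.ball x₀ R), ∀ᵐ x ∂volume.restrict (Metric.ball x₀ R),
      ‖F x - F z‖ₑ ≤ N x + N z + A) :
    IntegrableOn F (Metric.ball x₀ R) volume ∧
      ∫⁻ x in Metric.ball x₀ R, ‖F x - ⨍ z in Metric.ball x₀ R, F z‖ₑ ≤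
        2 * (∫⁻ x in Metric.ball x₀ R, N x) + A * volume (Metric.ball x₀ R) := by
  set B := Metric.ball x₀ R with hB
  set V := volume B with hV
  have hV0 : V ≠ 0 := (Metric.measure_ball_pos _ _ hR).ne'
  have hVt : V ≠ ∞ := measure_ball_lt_top.ne
  have : IsFiniteMeasure (volume.restrict B) := ⟨by simpa using measure_ball_lt_top⟩
  have : NeZero (volume.restrict B) := ⟨by simpa [Measure.restrict_eq_zero] using hV0⟩
  set I := ∫⁻ x in B, N x with hI
  have hint : ∀ u : ℝ≥0∞, ∫⁻ x in B, (N x + u + A) = I + u * V + A * V := by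
    intro u
    simp only [add_assoc]
    rw [lintegral_add_left' hN, lintegral_const, Measure.restrict_apply_univ, add_mul]
  have hfin : ∀ᵐ z ∂volume.restrict B, N z < ∞ := ae_lt_top' hN hNt
  obtain ⟨z₀, hz₀, hNz₀⟩ := (h.and hfin).exists
  have hsub : IntegrableOn (fun x => F x - F z₀) B volume := by
    refine ⟨(hF.restrict).sub aestronglyMeasurable_const, ?_⟩
    refine (lintegral_mono_ae hz₀).trans_lt ?_
    rw [hint]
    exact ENNReal.add_lt_top.2 ⟨ENNReal.add_lt_top.2 ⟨hNt.lt_top, ENNReal.mul_lt_top hNz₀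
      hVt.lt_top⟩, ENNReal.mul_lt_top hA.lt_top hVt.lt_top⟩
  have hFi : IntegrableOn F B volume := by
    have h' : IntegrableOn (fun x => F x - F z₀ + F z₀) B volume :=
      Integrable.add hsub (integrable_const (F z₀))
    simpa using h'
  refine ⟨hFi, ?_⟩
  have hpt : ∀ᵐ x ∂volume.restrict B, ‖F x - ⨍ z in B, F z‖ₑ ≤ N x + I / V + A := by
    filter_upwards [h] with x hx
    have e : F x - ⨍ z in B, F z = ⨍ z in B, (F x - F z) := by
      have hc : ⨍ _ in B, F x = F x := average_const _ _
      conv_lhs => rw [← hc]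
      simp only [setAverage_eq]
      rw [integral_sub (integrable_const _) hFi, smul_sub]
    have e₂ : ‖⨍ z in B, (F x - F z)‖ₑ ≤ V⁻¹ * ∫⁻ z in B, ‖F x - F z‖ₑ := by
      rw [setAverage_eq, enorm_smul]
      gcongr
      · rw [Real.enorm_eq_ofReal (by positivity), measureReal_def, ENNReal.ofReal_inv_of_pos
          (ENNReal.toReal_pos hV0 hVt), ENNReal.ofReal_toReal hVt]
      · exact enorm_integral_le_lintegral_enorm _
    rw [e]
    calc _ ≤ V⁻¹ * ∫⁻ z in B, ‖F x - F z‖ₑ := e₂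
      _ ≤ V⁻¹ * ∫⁻ z in B, (N z + N x + A) := by
          refine mul_le_mul' le_rfl (lintegral_mono_ae (hx.mono fun z hz => ?_))
          rwa [enorm_sub_rev]
      _ = V⁻¹ * V * N x + I / V + V⁻¹ * V * A := by rw [hint, ENNReal.div_eq_inv_mul]; ring
      _ = _ := by rw [ENNReal.inv_mul_cancel hV0 hVt, one_mul, one_mul]
  refine (lintegral_mono_ae hpt).trans (le_of_eq ?_)
  rw [hint, ENNReal.div_mul_cancel hV0 hVt, two_mul]

/-! ### The local part -/

section Near

variable {𝕜 : Type*} [RCLike 𝕜] {n m : ℕ}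

/-- The product of the linear fractional integrals of order `β i` of the functions `f i` over the
ball `B(x₀, 2R)`. -/
noncomputable def fracMajorant (β : Fin m → ℝ) (f : Fin m → Rn n → 𝕜) (x₀ : Rn n) (R : ℝ)
    (x : Rn n) : ℝ≥0∞ :=
  ∏ i, ∫⁻ y in Metric.ball x₀ (2 * R), ‖x - y‖ₑ ^ (β i - n) * ‖f i y‖ₑ

theorem aemeasurable_fractional {β : ℝ} {g : Rn n → ℝ≥0∞} (hg : AEMeasurable g volume)
    (μ : Measure (Rn n)) [SFinite μ] (s : Set (Rn n)) :
    AEMeasurable (fun x => ∫⁻ y in s, ‖x - y‖ₑ ^ (β - n) * g y) μ := by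
  have hk : Measurable (fun p : Rn n × Rn n => ‖p.1 - p.2‖ₑ ^ (β - n)) :=
    ((measurable_fst.sub measurable_snd).enorm).pow_const _
  exact AEMeasurable.lintegral_prod_right' (f := fun p : Rn n × Rn n =>
    ‖p.1 - p.2‖ₑ ^ (β - n) * g p.2) (hk.aemeasurable.mul hg.restrict.comp_snd)

theorem aemeasurable_fracMajorant {β : Fin m → ℝ} {f : Fin m → Rn n → 𝕜}
    (hf : ∀ i, AEStronglyMeasurable (f i) volume) (x₀ : Rn n) (R : ℝ) (μ : Measure (Rn n))
    [SFinite μ] : AEMeasurable (fracMajorant β f x₀ R) μ :=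
  Finset.aemeasurable_fun_prod _ fun i _ => aemeasurable_fractional (hf i).enorm μ _

/-- The local estimate: Hölder's inequality in `x` with all exponents equal to `m`, fractional
integration from `L^{q_i}` to `L^m`, and the reverse Hölder condition. -/
theorem exists_lintegral_fracMajorant_le (hn : 0 < n) (hm : 0 < m) {α δ : ℝ}
    {p : Fin m → ℝ≥0∞} (hp : ∀ i, 1 ≤ p i) {v : Fin m → Rn n → ℝ} (hv : ∀ i, IsWeight (v i))
    (hRH : ∀ i, 1 < p i → MemRH m (fun x => v i x ^ (-(p i).conjExponent.toReal)))
    {β e : Fin m → ℝ} {κ : ℝ} (hκ : 0 < κ) (he : ∀ i, 0 ≤ e i)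
    (hesum : ∑ i, e i = (m : ℝ) * n - α) (hβsum : ∑ i, β i = α + δ)
    (hβ : ∀ i, n * (1 - 1 / (m : ℝ)) * (p i)⁻¹.toReal < β i) :
    ∃ C : ℝ≥0, ∀ f : Fin m → Rn n → 𝕜,
      (∀ i, AEStronglyMeasurable (fun y => v i y • f i y) volume) →
      ∀ (x₀ : Rn n) (R : ℝ), 0 < R → ∫⁻ x in Metric.ball x₀ R, fracMajorant β f x₀ R x ≤
        C * (ENNReal.ofReal R ^ (n + δ) * ∏ i, (eLpNorm (fun y => v i y • f i y) (p i) volume *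
          weightNorm (v i) (p i).conjExponent κ (e i) x₀ R)) := by
  have hm' : (0 : ℝ) < m := by exact_mod_cast hm
  have hθ1 : ∀ i, (p i)⁻¹.toReal ≤ 1 := fun i =>
    ENNReal.toReal_le_of_le_ofReal zero_le_one (by simpa using hp i)
  set q : Fin m → ℝ := fun i => (1 / (m : ℝ) + (1 - 1 / m) * (p i)⁻¹.toReal)⁻¹ with hq
  have hq' : ∀ i, 1 / q i = 1 / (m : ℝ) + (1 - 1 / m) * (p i)⁻¹.toReal := fun i => by
    simp [hq]
  choose C₁ hC₁ using fun i => exists_fractional_ball_le (n := n) hm ENNReal.toReal_nonneg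
    (hθ1 i) (hβ i) (hq' i) hn
  choose C₂ hC₂ using fun i => exists_lintegral_ball_rpow_le (𝕜 := 𝕜) hn hm (hp i) (hv i) (hRH i)
    hκ (he i) (hq' i)
  refine ⟨∏ i, (C₁ i * C₂ i), fun f hf x₀ R hR => ?_⟩
  have hR0 : ENNReal.ofReal R ≠ 0 := by simpa using hR
  have hfm : ∀ i, AEMeasurable (fun y => ‖f i y‖ₑ) volume := fun i =>
    (aestronglyMeasurable_of_smul (hv i) (hf i)).enorm
  have H := ENNReal.lintegral_prod_norm_pow_le (μ := volume.restrict (Metric.ball x₀ R))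
    (Finset.univ : Finset (Fin m))
    (f := fun i x => (∫⁻ y in Metric.ball x₀ (2 * R), ‖x - y‖ₑ ^ (β i - n) * ‖f i y‖ₑ) ^ (m : ℝ))
    (p := fun _ => 1 / (m : ℝ))
    (fun i _ => (aemeasurable_fractional (hfm i) _ _).pow_const _)
    (by simp [hm'.ne']) (fun _ _ => by positivity)
  have e₁ : ∀ a : ℝ≥0∞, (a ^ (m : ℝ)) ^ (1 / (m : ℝ)) = a := fun a => by
    rw [← ENNReal.rpow_mul, mul_one_div_cancel hm'.ne', ENNReal.rpow_one]
  simp only [e₁] at H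
  refine H.trans ?_
  have hexp : ∑ i, ((β i - n * (1 - 1 / (m : ℝ)) * (p i)⁻¹.toReal) +
      (n * ((1 / (m : ℝ) - 1) * (1 - (p i)⁻¹.toReal)) + e i)) = n + δ := by
    have : ∀ i, ((β i - n * (1 - 1 / (m : ℝ)) * (p i)⁻¹.toReal) +
      (n * ((1 / (m : ℝ) - 1) * (1 - (p i)⁻¹.toReal)) + e i)) =
        β i + e i + n * (1 / (m : ℝ) - 1) := fun i => by ring
    simp only [this]
    rw [Finset.sum_add_distrib, Finset.sum_add_distrib, hβsum, hesum]
    simp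
    field_simp
    ring
  have hpow : ∏ i : Fin m, ENNReal.ofReal R ^ ((β i - n * (1 - 1 / (m : ℝ)) * (p i)⁻¹.toReal) +
      (n * ((1 / (m : ℝ) - 1) * (1 - (p i)⁻¹.toReal)) + e i)) = ENNReal.ofReal R ^ (n + δ) := by
    rw [← hexp]
    simp only [ENNReal.ofReal_rpow_of_pos hR]
    rw [Real.rpow_sum_of_pos hR, ENNReal.ofReal_prod_of_nonneg fun _ _ => by positivity]
  calc _ ≤ ∏ i, ((C₁ i * C₂ i : ℝ≥0) : ℝ≥0∞) * (ENNReal.ofReal R ^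
        ((β i - n * (1 - 1 / (m : ℝ)) * (p i)⁻¹.toReal) +
          (n * ((1 / (m : ℝ) - 1) * (1 - (p i)⁻¹.toReal)) + e i)) *
        (eLpNorm (fun y => v i y • f i y) (p i) volume *
          weightNorm (v i) (p i).conjExponent κ (e i) x₀ R)) := by
        refine Finset.prod_le_prod' fun i _ => ?_
        refine (hC₁ i _ (hfm i) x₀ R hR).trans ?_
        rw [ENNReal.rpow_add _ _ hR0 ENNReal.ofReal_ne_top]
        refine (mul_le_mul' le_rfl (mul_le_mul' le_rfl (hC₂ i (f i) (hf i) x₀ R hR))).trans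
          (le_of_eq ?_)
        push_cast
        ring
    _ = _ := by
        rw [Finset.prod_mul_distrib, Finset.prod_mul_distrib, hpow, ENNReal.ofNNReal_finsetProd]

end Near

/-! ### Increments of the integrands -/

section Increment

variable {𝕜 : Type*} [RCLike 𝕜] {n m : ℕ}

/-- The increments of the integrands of the commutator between two points of a ball: the part of
the integral over `B(x₀, 2R)^m` is estimated by size, the remainder by smoothness. -/
theorem exists_lintegral_increment_le {α γ δ : ℝ} (hα : α < (m : ℝ) * n) (hδ : 0 < δ)
    (hδγ : δ < γ) {K : Rn n → (Fin m → Rn n) → 𝕜} (hK : IsFractionalKernel α γ K)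
    {b : Fin m → Rn n → 𝕜} (hb : ∀ i, MemLambda δ (b i))
    {p : Fin m → ℝ≥0∞} (hp : ∀ i, 1 ≤ p i) {v : Fin m → Rn n → ℝ} (hv : ∀ i, IsWeight (v i))
    {β e : Fin m → ℝ} {κ : ℝ} (hκ : 0 < κ) (he : ∀ i, 0 ≤ e i)
    (hesum : ∑ i, e i = (m : ℝ) * n - α) (hβsum : ∑ i, β i = α + δ) (hβ : ∀ i, β i ≤ n) :
    ∃ C : ℝ≥0, ∀ f : Fin m → Rn n → 𝕜,
      (∀ i, AEStronglyMeasurable (fun y => v i y • f i y) volume) →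
      ∀ (x₀ : Rn n) (R : ℝ), 0 < R → ∀ x ∈ Metric.ball x₀ R, ∀ z ∈ Metric.ball x₀ R, ∀ j,
      ∫⁻ y, ‖commIntegrand K b f j x y - commIntegrand K b f j z y‖ₑ ≤
        C * (fracMajorant β f x₀ R x + fracMajorant β f x₀ R z +
          ENNReal.ofReal R ^ δ * ∏ i, (eLpNorm (fun y => v i y • f i y) (p i) volume *
          weightNorm (v i) (p i).conjExponent κ (e i) x₀ R)) := by
  choose C₁ hC₁ using fun j => exists_enorm_sub_mul_kernel_le hδ hK (hb j) j hβ hβsum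
  choose C₂ hC₂0 hC₂ using fun j =>
    exists_norm_increment_le hα hδ hδγ hK (hb j) j hκ he hesum
  refine ⟨∑ j, (C₁ j + (C₂ j).toNNReal), fun f hf x₀ R hR x hx z hz j => ?_⟩
  set C := ∑ j, (C₁ j + (C₂ j).toNNReal) with hC
  have hCj : C₁ j + (C₂ j).toNNReal ≤ C :=
    Finset.single_le_sum (f := fun j => C₁ j + (C₂ j).toNNReal) (fun _ _ => zero_le)
      (Finset.mem_univ j)
  have hC1 : (C₁ j : ℝ≥0∞) ≤ C := by exact_mod_cast le_self_add.trans hCj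
  have hC2 : ENNReal.ofReal (C₂ j) ≤ C := by
    have : (C₂ j).toNNReal ≤ C := le_add_self.trans hCj
    exact ENNReal.coe_le_coe.2 this
  have hfm : ∀ i, AEMeasurable (fun y => ‖f i y‖ₑ) volume := fun i =>
    (aestronglyMeasurable_of_smul (hv i) (hf i)).enorm
  have henorm : ∀ y : Fin m → Rn n, ‖∏ i, f i (y i)‖ₑ = ∏ i, ‖f i (y i)‖ₑ := fun y => by
    simp only [← ofReal_norm]
    rw [norm_prod, ENNReal.ofReal_prod_of_nonneg fun _ _ => norm_nonneg _]
  set Q : Set (Fin m → Rn n) := Set.univ.pi fun _ => Metric.ball x₀ (2 * R) with hQ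
  have hQm : MeasurableSet Q :=
    MeasurableSet.univ_pi fun _ => Metric.isOpen_ball.measurableSet
  set Φ : Rn n → (Fin m → Rn n) → ℝ≥0∞ := fun u y =>
    ∏ i, (‖u - y i‖ₑ ^ (β i - n) * ‖f i (y i)‖ₑ) with hΦ
  have hkm : ∀ u i, AEMeasurable (fun y => ‖u - y‖ₑ ^ (β i - n) * ‖f i y‖ₑ) volume :=
    fun u i => AEMeasurable.mul
      (((measurable_const.sub measurable_id).enorm).pow_const _).aemeasurable (hfm i)
  have hΦint : ∀ u, ∫⁻ y in Q, Φ u y = fracMajorant β f x₀ R u := by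
    intro u
    rw [hQ, volume_pi, Measure.restrict_pi_pi, hΦ]
    exact lintegral_pi_prod (fun _ : Fin m => volume.restrict (Metric.ball x₀ (2 * R)))
      (fun i y => ‖u - y‖ₑ ^ (β i - n) * ‖f i y‖ₑ) fun i => (hkm u i).restrict
  have hΦm : ∀ u, AEMeasurable (Φ u) volume := fun u =>
    Finset.aemeasurable_fun_prod _ fun i _ => (hkm u i).comp_quasiMeasurePreserving
      (Measure.quasiMeasurePreserving_eval (fun _ : Fin m => (volume : Measure (Rn n))) i)
  have hptΦ : ∀ u y, ‖commIntegrand K b f j u y‖ₑ ≤ C * Φ u y := by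
    intro u y
    rw [commIntegrand, enorm_mul, henorm, hΦ]
    simp only
    rw [Finset.prod_mul_distrib, ← mul_assoc]
    exact mul_le_mul' ((hC₁ j u y).trans (mul_le_mul' hC1 le_rfl)) le_rfl
  have hnear : ∫⁻ y in Q, ‖commIntegrand K b f j x y - commIntegrand K b f j z y‖ₑ ≤
      C * (fracMajorant β f x₀ R x + fracMajorant β f x₀ R z) := by
    calc _ ≤ ∫⁻ y in Q, C * (Φ x y + Φ z y) := by
          refine lintegral_mono fun y => (enorm_sub_le).trans ?_
          rw [mul_add]
          exact add_le_add (hptΦ x y) (hptΦ z y)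
      _ = _ := by
          rw [lintegral_const_mul' _ _ ENNReal.coe_ne_top,
            lintegral_add_left' (hΦm x).restrict, hΦint, hΦint]
  set Ψ : (Fin m → Rn n) → ℝ≥0∞ := fun y =>
    ∏ i, (‖f i (y i)‖ₑ * ENNReal.ofReal ((κ * R + ‖x₀ - y i‖) ^ (-e i))) with hΨ
  have hptΨ : ∀ y ∈ Qᶜ, ‖commIntegrand K b f j x y - commIntegrand K b f j z y‖ₑ ≤
      C * ENNReal.ofReal R ^ δ * Ψ y := by
    intro y hy
    have hy' : ∃ i, y i ∉ Metric.ball x₀ (2 * R) := by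
      simpa only [hQ, Set.mem_compl_iff, Set.mem_univ_pi, not_forall] using hy
    have h1 := hC₂ j x₀ R hR x hx z hz y hy'
    have h2 : ‖(b j x - b j (y j)) * K x y - (b j z - b j (y j)) * K z y‖ₑ ≤
        C * (ENNReal.ofReal R ^ δ *
          ∏ i, ENNReal.ofReal ((κ * R + ‖x₀ - y i‖) ^ (-e i))) := by
      rw [← ofReal_norm]
      refine (ENNReal.ofReal_le_ofReal h1).trans ?_
      rw [ENNReal.ofReal_mul (hC₂0 j), ENNReal.ofReal_mul (by positivity),
        ENNReal.ofReal_prod_of_nonneg fun i _ => by positivity, ENNReal.ofReal_rpow_of_pos hR]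
      exact mul_le_mul' hC2 le_rfl
    rw [commIntegrand, commIntegrand, ← sub_mul, enorm_mul, henorm, hΨ]
    simp only
    rw [Finset.prod_mul_distrib]
    refine (mul_le_mul' h2 le_rfl).trans (le_of_eq ?_)
    ring
  have hem : ∀ i, AEMeasurable (fun y => ‖f i y‖ₑ *
      ENNReal.ofReal ((κ * R + ‖x₀ - y‖) ^ (-e i))) volume := fun i => by
    refine (hfm i).mul (Measurable.aemeasurable ?_)
    fun_prop
  have hfar : ∫⁻ y in Qᶜ, ‖commIntegrand K b f j x y - commIntegrand K b f j z y‖ₑ ≤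
      C * (ENNReal.ofReal R ^ δ * ∏ i, (eLpNorm (fun y => v i y • f i y) (p i) volume *
          weightNorm (v i) (p i).conjExponent κ (e i) x₀ R)) := by
    calc _ ≤ ∫⁻ y in Qᶜ, C * ENNReal.ofReal R ^ δ * Ψ y :=
          setLIntegral_mono' hQm.compl hptΨ
      _ ≤ ∫⁻ y, C * ENNReal.ofReal R ^ δ * Ψ y := setLIntegral_le_lintegral _ _
      _ = C * ENNReal.ofReal R ^ δ * ∫⁻ y, Ψ y :=
          lintegral_const_mul' _ _ (ENNReal.mul_ne_top (by simp)
            (ENNReal.rpow_ne_top_of_nonneg hδ.le (by simp)))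
      _ = C * ENNReal.ofReal R ^ δ * ∏ i, ∫⁻ y, ‖f i y‖ₑ *
            ENNReal.ofReal ((κ * R + ‖x₀ - y‖) ^ (-e i)) := by
          congr 1
          exact lintegral_pi_prod (fun _ : Fin m => (volume : Measure (Rn n)))
            (fun i y => ‖f i y‖ₑ * ENNReal.ofReal ((κ * R + ‖x₀ - y‖) ^ (-e i))) hem
      _ ≤ _ := by
          rw [mul_assoc]
          refine mul_le_mul' le_rfl (mul_le_mul' le_rfl (Finset.prod_le_prod' fun i _ => ?_))
          exact lintegral_div_le_weightNorm (hp i) (hv i) (hf i) hκ (e i) x₀ hR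
  rw [← lintegral_add_compl _ hQm, mul_add]
  exact add_le_add hnear hfar

end Increment

/-! ### The weight class and the choice of exponents -/

theorem invMass_ball_ne_zero {n : ℕ} {w : Rn n → ℝ} (hw : IsWeight w) (x₀ : Rn n) {R : ℝ}
    (hR : 0 < R) : invMass w (Metric.ball x₀ R) ≠ 0 := by
  intro h
  have hm : AEMeasurable (fun x => ENNReal.ofReal (w x)⁻¹) (volume.restrict (Metric.ball x₀ R)) :=
    hw.aestronglyMeasurable_inv.aemeasurable.ennreal_ofReal.restrict
  have h0 := (lintegral_eq_zero_iff' hm).1 h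
  have hne : volume.restrict (Metric.ball x₀ R) ≠ 0 := by
    simpa [Measure.restrict_eq_zero] using (Metric.measure_ball_pos volume x₀ hR).ne'
  have : (ae (volume.restrict (Metric.ball x₀ R))).NeBot := ae_neBot.2 hne
  obtain ⟨x, hx, hx'⟩ := (h0.and (ae_restrict_of_ae hw.2)).exists
  have : 0 < ENNReal.ofReal (w x)⁻¹ := by simpa using hx'
  exact this.ne' hx

theorem weightNorm_ne_zero {n : ℕ} {v : Rn n → ℝ} (hv : IsWeight v) {p : ℝ≥0∞} (hp : p ≠ 0)
    {κ : ℝ} (hκ : 0 < κ) (e : ℝ) (x₀ : Rn n) {R : ℝ} (hR : 0 < R) :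
    weightNorm v p κ e x₀ R ≠ 0 := by
  intro h
  have hmeas := hv.aestronglyMeasurable_inv_div κ e x₀ R
  have h0 := (eLpNorm_eq_zero_iff hmeas hp).1 h
  obtain ⟨y, hy, hy'⟩ := (h0.and hv.2).exists
  have hpos : 0 < κ * R + ‖x₀ - y‖ := by positivity
  have : 0 < (v y)⁻¹ / (κ * R + ‖x₀ - y‖) ^ e := by positivity
  exact this.ne' hy

/-- The class `ℋ_m` in terms of the radius: its exponents `e i` have sum `m n - α`, the weight norms
are finite, and their product times `R ^ (n + δ)` is at most a constant multiple of
`w⁻¹(B) |B| ^ (δ' / n)`. -/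
theorem MemH.exists_weightNorm_le {n m : ℕ} (hn : 0 < n) (hm : 0 < m) {α δ δ' : ℝ} (hδ : 0 < δ)
    {p : Fin m → ℝ≥0∞} {w : Rn n → ℝ} {v : Fin m → Rn n → ℝ} (hw : IsWeight w)
    (hv : ∀ i, IsWeight (v i)) (hH : MemH p (α + δ) δ δ' w v) :
    ∃ κ : ℝ, 0 < κ ∧ ∃ e : Fin m → ℝ, (∀ i, 0 ≤ e i) ∧ ∑ i, e i = (m : ℝ) * n - α ∧
      (∀ (x₀ : Rn n) (R : ℝ), 0 < R → ∀ i, weightNorm (v i) (p i).conjExponent κ (e i) x₀ R ≠ ∞) ∧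
      ∃ C : ℝ≥0, ∀ (x₀ : Rn n) (R : ℝ), 0 < R →
        ENNReal.ofReal R ^ (n + δ) * ∏ i, weightNorm (v i) (p i).conjExponent κ (e i) x₀ R ≤
          C * (invMass w (Metric.ball x₀ R) * volume (Metric.ball x₀ R) ^ (δ' / n)) := by
  obtain ⟨hWt, β', hβ', hsum, C, hC⟩ := hH
  have hn' : (0 : ℝ) < n := by exact_mod_cast hn
  have hm' : (0 : ℝ) < m := by exact_mod_cast hm
  set ω := volume (Metric.ball (0 : Rn n) 1) with hω
  have hω0 : ω ≠ 0 := (Metric.measure_ball_pos _ _ one_pos).ne'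
  have hωt : ω ≠ ∞ := measure_ball_lt_top.ne
  set κ : ℝ := ω.toReal ^ (1 / (n : ℝ)) with hκ
  have hκ0 : 0 < κ := Real.rpow_pos_of_pos (ENNReal.toReal_pos hω0 hωt) _
  set e : Fin m → ℝ := fun i => (n : ℝ) - β' i + δ / m with he
  have hside : ∀ (x₀ : Rn n) (R : ℝ), 0 < R →
      volume.real (Metric.ball x₀ R) ^ (1 / (n : ℝ)) = κ * R := by
    intro x₀ R hR
    rw [measureReal_def, volume_ball_eq hn x₀ hR, ENNReal.toReal_mul, ← ENNReal.toReal_rpow,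
      ENNReal.toReal_ofReal hR.le, Real.mul_rpow (by positivity) ENNReal.toReal_nonneg,
      ← Real.rpow_mul hR.le, mul_one_div_cancel hn'.ne', Real.rpow_one, mul_comm]
  have hconj : ∀ i, (p i).conjExponent ≠ 0 := fun i => by
    rw [ENNReal.conjExponent]; exact (zero_lt_one.trans_le le_self_add).ne'
  have key : ∀ (x₀ : Rn n) (R : ℝ), 0 < R →
      volume (Metric.ball x₀ R) ^ (1 + (δ - δ') / n) *
        ∏ i, weightNorm (v i) (p i).conjExponent κ (e i) x₀ R ≤
          C * invMass w (Metric.ball x₀ R) := by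
    intro x₀ R hR
    have h := hC x₀ R hR
    rw [hside x₀ R hR] at h
    have hW0 := invMass_ball_ne_zero hw x₀ hR
    have hWt' := (hWt x₀ R hR).ne
    rw [ENNReal.div_eq_inv_mul, mul_assoc, ← ENNReal.div_eq_inv_mul,
      ENNReal.div_le_iff hW0 hWt'] at h
    exact h
  refine ⟨κ, hκ0, e, fun i => ?_, ?_, ?_, ?_⟩
  · have := (hβ' i).2
    have : 0 < δ / m := by positivity
    simp only [he]; linarith
  · simp only [he]
    rw [Finset.sum_add_distrib, Finset.sum_sub_distrib, hsum]
    simp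
    field_simp
    ring
  -- all factors are nonzero, so an infinite factor would make the whole product infinite
  · intro x₀ R hR i htop
    have hVpos : volume (Metric.ball x₀ R) ^ (1 + (δ - δ') / n) ≠ 0 :=
      (ENNReal.rpow_pos (Metric.measure_ball_pos _ _ hR) measure_ball_lt_top.ne).ne'
    have hprod : ∏ i, weightNorm (v i) (p i).conjExponent κ (e i) x₀ R = ∞ := by
      rw [← Finset.mul_prod_erase _ _ (Finset.mem_univ i), htop]
      exact ENNReal.top_mul (Finset.prod_ne_zero_iff.2 fun k _ =>
        weightNorm_ne_zero (hv k) (hconj k) hκ0 _ _ hR)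
    have h := key x₀ R hR
    rw [hprod, ENNReal.mul_top hVpos, top_le_iff] at h
    exact ENNReal.mul_ne_top ENNReal.coe_ne_top (hWt x₀ R hR).ne h
  · have hct : (ω ^ (1 + δ / n))⁻¹ ≠ ∞ := by
      rw [← ENNReal.rpow_neg]
      exact ENNReal.rpow_ne_top_of_ne_zero hω0 hωt
    refine ⟨(ω ^ (1 + δ / n))⁻¹.toNNReal * C, fun x₀ R hR => ?_⟩
    rw [ENNReal.coe_mul, ENNReal.coe_toNNReal hct]
    set V := volume (Metric.ball x₀ R) with hV
    have hV0 : V ≠ 0 := (Metric.measure_ball_pos _ _ hR).ne'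
    have hVt : V ≠ ∞ := measure_ball_lt_top.ne
    set T := ∏ i, weightNorm (v i) (p i).conjExponent κ (e i) x₀ R with hT
    have hRV : ENNReal.ofReal R ^ (n + δ) = (ω ^ (1 + δ / n))⁻¹ * V ^ (1 + δ / n) := by
      rw [hV, volume_ball_eq hn x₀ hR, ← hω, ENNReal.mul_rpow_of_nonneg _ _ (by positivity),
        ← ENNReal.rpow_mul, show (n : ℝ) * (1 + δ / n) = n + δ by field_simp, mul_comm (_ ^ _),
        ← mul_assoc, ENNReal.inv_mul_cancel, one_mul]
      · exact (ENNReal.rpow_pos (pos_iff_ne_zero.2 hω0) hωt).ne'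
      · exact ENNReal.rpow_ne_top_of_ne_zero hω0 hωt
    calc ENNReal.ofReal R ^ (n + δ) * T
        = (ω ^ (1 + δ / n))⁻¹ * ((V ^ (1 + (δ - δ') / n) * T) * V ^ (δ' / n)) := by
          rw [hRV, show 1 + δ / n = 1 + (δ - δ') / n + δ' / n by ring,
            ENNReal.rpow_add (1 + (δ - δ') / n) _ hV0 hVt]
          ring
      _ ≤ (ω ^ (1 + δ / n))⁻¹ * ((C * invMass w (Metric.ball x₀ R)) * V ^ (δ' / n)) := by
          exact mul_le_mul' le_rfl (mul_le_mul' (key x₀ R hR) le_rfl)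
      _ = _ := by ring

/-- Orders `β i` for the linear fractional integrals in the local estimate. The condition
`p > n / (α + δ)` leaves room for them above the critical orders and below `n`. -/
theorem exists_fractional_orders {n m : ℕ} (hn : 0 < n) (hm : 0 < m) {a : ℝ} (ha : 0 < a)
    (ha' : a < (m : ℝ) * n) {p : Fin m → ℝ≥0∞} (hp : ∀ i, 1 ≤ p i)
    (hp_gt : ENNReal.ofReal (n / a) < totalExponent p) :
    ∃ β : Fin m → ℝ, ∑ i, β i = a ∧
      ∀ i, n * (1 - 1 / (m : ℝ)) * (p i)⁻¹.toReal < β i ∧ β i ≤ n := by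
  have hn' : (0 : ℝ) < n := by exact_mod_cast hn
  have hm' : (0 : ℝ) < m := by exact_mod_cast hm
  have hm0 : (0 : ℝ) < 1 / m := by positivity
  have hm1 : (0 : ℝ) ≤ 1 - 1 / m := by
    rw [sub_nonneg, div_le_one hm']; exact_mod_cast hm
  set θ : Fin m → ℝ := fun i => (p i)⁻¹.toReal with hθ
  have hθ0 : ∀ i, 0 ≤ θ i := fun i => ENNReal.toReal_nonneg
  have hθ1 : ∀ i, θ i ≤ 1 := fun i =>
    ENNReal.toReal_le_of_le_ofReal zero_le_one (by simpa using hp i)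
  have hpt : ∀ i ∈ Finset.univ, (p i)⁻¹ ≠ ∞ := fun i _ => by
    simpa using (zero_lt_one.trans_le (hp i)).ne'
  have hsum : ∑ i, θ i < a / n := by
    rw [totalExponent, ENNReal.lt_inv_iff_lt_inv, ← ENNReal.ofReal_inv_of_pos (by positivity),
      inv_div] at hp_gt
    rw [hθ, ← ENNReal.toReal_sum hpt]
    exact (ENNReal.lt_ofReal_iff_toReal_lt (ENNReal.sum_ne_top.2 hpt)).1 hp_gt
  set ℓ : Fin m → ℝ := fun i => n * (1 - 1 / (m : ℝ)) * θ i with hℓ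
  have hℓn : ∀ i, ℓ i < n := fun i => by
    have : (1 - 1 / (m : ℝ)) * θ i ≤ 1 - 1 / m := mul_le_of_le_one_right hm1 (hθ1 i)
    simp only [hℓ]
    nlinarith
  have hℓsum : ∑ i, ℓ i < a := by
    simp only [hℓ]
    rw [← Finset.mul_sum]
    have h1 : (n : ℝ) * ∑ i, θ i < a := by
      rw [lt_div_iff₀ hn'] at hsum; linarith
    have h2 : 0 ≤ ∑ i, θ i := Finset.sum_nonneg fun i _ => hθ0 i
    nlinarith [mul_nonneg (mul_nonneg hn'.le hm0.le) h2]
  set Λ := ∑ i, ℓ i with hΛ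
  -- the point of the segment from `ℓ` to `(n, ..., n)` whose coordinates have sum `a`
  set t : ℝ := (a - Λ) / (m * n - Λ) with ht
  have hd : 0 < (m : ℝ) * n - Λ := by linarith
  have ht0 : 0 < t := div_pos (by linarith) hd
  have ht1 : t ≤ 1 := by rw [ht, div_le_one hd]; linarith
  refine ⟨fun i => ℓ i + t * (n - ℓ i), ?_, fun i => ⟨?_, ?_⟩⟩
  · have h : ∑ i, t * (n - ℓ i) = t * (m * n - Λ) := by
      rw [← Finset.mul_sum, Finset.sum_sub_distrib, ← hΛ]
      simp
    rw [Finset.sum_add_distrib, h, ← hΛ, ht, div_mul_cancel₀ _ hd.ne']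
    ring
  · have := mul_pos ht0 (sub_pos.2 (hℓn i))
    change ℓ i < _
    linarith
  · have := hℓn i
    change ℓ i + t * (n - ℓ i) ≤ n
    nlinarith

/-! ### The commutator modulo constants -/

section Commutator

variable {𝕜 : Type*} [RCLike 𝕜] {n m : ℕ}

theorem aestronglyMeasurable_commIntegrand {α γ δ : ℝ} (hδ : 0 < δ)
    {K : Rn n → (Fin m → Rn n) → 𝕜} (hK : IsFractionalKernel α γ K) {b : Fin m → Rn n → 𝕜}
    (hb : ∀ i, MemLambda δ (b i)) {f : Fin m → Rn n → 𝕜}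
    (hf : ∀ i, AEStronglyMeasurable (f i) volume) (j : Fin m) :
    AEStronglyMeasurable (fun q : Rn n × (Fin m → Rn n) => commIntegrand K b f j q.1 q.2)
      (volume.prod volume) := by
  have hbc := (hb j).continuous hδ
  have h1 : Continuous fun q : Rn n × (Fin m → Rn n) => b j q.1 - b j (q.2 j) := by fun_prop
  have h2 : AEStronglyMeasurable (fun y : Fin m → Rn n => ∏ i, f i (y i)) volume :=
    Finset.aestronglyMeasurable_fun_prod _ fun i _ => (hf i).comp_quasiMeasurePreserving
      (Measure.quasiMeasurePreserving_eval (fun _ : Fin m => (volume : Measure (Rn n))) i)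
  exact (h1.aestronglyMeasurable.mul hK.measurable).mul h2.comp_snd

theorem isCommModConst_sumCommutator {K : Rn n → (Fin m → Rn n) → 𝕜} {b f : Fin m → Rn n → 𝕜}
    (h : CommConverges K b f) : IsCommModConst K b f (sumCommutator K b f) := by
  have h' := Filter.eventually_all.2 h
  filter_upwards [h'] with z hz
  filter_upwards [h'] with x hx
  refine ⟨fun j => (hx j).sub (hz j), ?_⟩
  rw [sumCommutator, sumCommutator, ← Finset.sum_sub_distrib]
  exact Finset.sum_congr rfl fun j _ => (integral_sub (hx j) (hz j)).symm

/-- If the increments of the integrands are integrable for all pairs of points of a set of full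
measure, normalizing at one point of this set gives a commutator modulo constants. -/
theorem exists_isCommModConst {K : Rn n → (Fin m → Rn n) → 𝕜} {b f : Fin m → Rn n → 𝕜}
    {G : Set (Rn n)} (hG : ∀ᵐ x, x ∈ G)
    (hint : ∀ x ∈ G, ∀ z ∈ G, ∀ j,
      Integrable (fun y => commIntegrand K b f j x y - commIntegrand K b f j z y) volume) :
    ∃ F : Rn n → 𝕜, IsCommModConst K b f F := by
  obtain ⟨z₀, hz₀⟩ := hG.exists
  refine ⟨fun x => ∑ j, ∫ y, (commIntegrand K b f j x y - commIntegrand K b f j z₀ y), ?_⟩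
  filter_upwards [hG] with z hz
  filter_upwards [hG] with x hx
  refine ⟨hint x hx z hz, ?_⟩
  rw [← Finset.sum_sub_distrib]
  refine Finset.sum_congr rfl fun j _ => ?_
  rw [← integral_sub (hint x hx z₀ hz₀ j) (hint z hz z₀ hz₀ j)]
  simp

theorem IsCommModConst.aestronglyMeasurable {K : Rn n → (Fin m → Rn n) → 𝕜}
    {b f : Fin m → Rn n → 𝕜} {F : Rn n → 𝕜}
    (hm : ∀ j, AEStronglyMeasurable
      (fun q : Rn n × (Fin m → Rn n) => commIntegrand K b f j q.1 q.2) (volume.prod volume))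
    (hF : IsCommModConst K b f F) : AEStronglyMeasurable F volume := by
  have hsec := Filter.eventually_all.2 fun j => (hm j).prodMk_left
  obtain ⟨z, hz, hzm⟩ := (hF.and hsec).exists
  have h : AEStronglyMeasurable (fun x => (∑ j, ∫ y,
      (commIntegrand K b f j x y - commIntegrand K b f j z y)) + F z) volume := by
    refine AEStronglyMeasurable.add (Finset.aestronglyMeasurable_fun_sum _ fun j _ => ?_)
      aestronglyMeasurable_const
    exact AEStronglyMeasurable.integral_prod_right'
      (f := fun q : Rn n × (Fin m → Rn n) =>
        commIntegrand K b f j q.1 q.2 - commIntegrand K b f j z q.2)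
      ((hm j).sub (hzm j).comp_snd)
  refine h.congr ?_
  filter_upwards [hz] with x hx
  rw [← hx.2, sub_add_cancel]

end Commutator

end MultiFrac

theorem theorem1p1 {𝕜 : Type*} [RCLike 𝕜] {n m : ℕ} (α γ δ δ' : ℝ)
    (hα : 0 < α) (hαmn : α < (m : ℝ) * n) (hγ : 0 < γ) (hγ1 : γ ≤ 1)
    (hδ : 0 < δ) (hδ_lt : δ < min γ ((m : ℝ) * n - α)) (hδ' : δ' ≤ δ)
    (K : Rn n → (Fin m → Rn n) → 𝕜) (hK : IsFractionalKernel α γ K)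
    (p : Fin m → ℝ≥0∞) (hp : ∀ i, 1 ≤ p i)
    (hp_gt : ENNReal.ofReal (n / (α + δ)) < totalExponent p)
    (b : Fin m → Rn n → 𝕜) (hb : ∀ i, MemLambda δ (b i))
    (w : Rn n → ℝ) (v : Fin m → Rn n → ℝ)
    (hw : IsWeight w) (hv : ∀ i, IsWeight (v i))
    (hH : MemH p (α + δ) δ δ' w v)
    (hRH : ∀ i, 1 < p i → MemRH m (fun x => v i x ^ (-(p i).conjExponent.toReal))) :
    ∃ C : ℝ≥0, 0 < C ∧ ∀ f : Fin m → Rn n → 𝕜,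
      (∀ i, MemLp (fun x => v i x • f i x) (p i) volume) →
        (CommConverges K b f →
          MemLip w δ' (sumCommutator K b f) ∧
          lipSeminorm w δ' (sumCommutator K b f) ≤
            C * ∏ i, eLpNorm (fun x => v i x • f i x) (p i) volume) ∧
        (∃ F : Rn n → 𝕜, IsCommModConst K b f F ∧ MemLip w δ' F ∧
          lipSeminorm w δ' F ≤
            C * ∏ i, eLpNorm (fun x => v i x • f i x) (p i) volume) := by
  obtain ⟨hδγ, hδα⟩ := lt_min_iff.1 hδ_lt
  have hmn : (0 : ℝ) < (m : ℝ) * n := hα.trans hαmn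
  have hn : 0 < n := Nat.pos_of_ne_zero (by rintro rfl; simp at hmn)
  have hm : 0 < m := Nat.pos_of_ne_zero (by rintro rfl; simp at hmn)
  obtain ⟨κ, hκ, e, he, hesum, hNt, C₃, hC₃⟩ := hH.exists_weightNorm_le hn hm hδ hw hv
  obtain ⟨β, hβsum, hβ⟩ := exists_fractional_orders hn hm (add_pos hα hδ) (by linarith) hp hp_gt
  obtain ⟨C₁, hC₁⟩ := exists_lintegral_fracMajorant_le (𝕜 := 𝕜) hn hm hp hv hRH hκ he hesum
    hβsum fun i => (hβ i).1
  obtain ⟨C₂, hC₂⟩ := exists_lintegral_increment_le hαmn hδ hδγ hK hb hp hv hκ he hesum hβsum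
    fun i => (hβ i).2
  set ω := volume (Metric.ball (0 : Rn n) 1) with hω
  have hωt : ω ≠ ∞ := measure_ball_lt_top.ne
  set C : ℝ≥0 := (2 * (m * C₂ * C₁) + m * C₂ * ω.toNNReal) * C₃ with hC
  refine ⟨C + 1, by positivity, fun f hf => ?_⟩
  have hvf := fun i => (hf i).aestronglyMeasurable
  have hfm := fun i => aestronglyMeasurable_of_smul (hv i) (hvf i)
  have hI := aestronglyMeasurable_commIntegrand hδ hK hb hfm
  set P := ∏ i, eLpNorm (fun x => v i x • f i x) (p i) volume with hP
  have hPt : P ≠ ∞ := ENNReal.prod_ne_top fun i _ => (hf i).2.ne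
  set W : Rn n → ℝ → ℝ≥0∞ := fun x₀ R => ∏ i, (eLpNorm (fun y => v i y • f i y) (p i) volume *
    weightNorm (v i) (p i).conjExponent κ (e i) x₀ R) with hW
  have hWt : ∀ x₀ R, 0 < R → W x₀ R ≠ ∞ := fun x₀ R hR =>
    ENNReal.prod_ne_top fun i _ => ENNReal.mul_ne_top (hf i).2.ne (hNt x₀ R hR i)
  have hRt : ∀ (R t : ℝ), 0 < R → ENNReal.ofReal R ^ t ≠ ∞ := fun R t hR =>
    ENNReal.rpow_ne_top_of_ne_zero (by simpa using hR) ENNReal.ofReal_ne_top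
  have hMt : ∀ (x₀ : Rn n) (R : ℝ), 0 < R →
      ∫⁻ x in Metric.ball x₀ R, fracMajorant β f x₀ R x ≠ ∞ := fun x₀ R hR =>
    ((hC₁ f hvf x₀ R hR).trans_lt (ENNReal.mul_lt_top ENNReal.coe_lt_top
      (ENNReal.mul_lt_top (hRt R _ hR).lt_top (hWt x₀ R hR).lt_top))).ne
  have hMm : ∀ (x₀ : Rn n) (R : ℝ), AEMeasurable (fracMajorant β f x₀ R)
      (volume.restrict (Metric.ball x₀ R)) := fun x₀ R => aemeasurable_fracMajorant hfm x₀ R _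
  -- every commutator modulo constants satisfies the estimate
  have main : ∀ F : Rn n → 𝕜, IsCommModConst K b f F →
      MemLip w δ' F ∧ lipSeminorm w δ' F ≤ (C + 1 : ℝ≥0) * P := by
    intro F hF
    have hFm := hF.aestronglyMeasurable hI
    have hball : ∀ (x₀ : Rn n) (R : ℝ), 0 < R → IntegrableOn F (Metric.ball x₀ R) volume ∧
        ∫⁻ x in Metric.ball x₀ R, ‖F x - ⨍ z in Metric.ball x₀ R, F z‖ₑ ≤
          2 * (∫⁻ x in Metric.ball x₀ R, m * C₂ * fracMajorant β f x₀ R x) +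
            m * C₂ * (ENNReal.ofReal R ^ δ * W x₀ R) * volume (Metric.ball x₀ R) := by
      intro x₀ R hR
      refine integrableOn_and_lintegral_sub_average_le hFm hR ((hMm x₀ R).const_mul _) ?_ ?_ ?_
      · rw [lintegral_const_mul'' _ (hMm x₀ R)]
        exact ENNReal.mul_ne_top (ENNReal.mul_ne_top (by simp) (by simp)) (hMt x₀ R hR)
      · exact ENNReal.mul_ne_top (ENNReal.mul_ne_top (by simp) (by simp))
          (ENNReal.mul_ne_top (hRt R _ hR) (hWt x₀ R hR))
      · filter_upwards [ae_restrict_of_ae hF, ae_restrict_mem Metric.isOpen_ball.measurableSet]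
          with z hz hzB
        filter_upwards [ae_restrict_of_ae hz, ae_restrict_mem Metric.isOpen_ball.measurableSet]
          with x hx hxB
        rw [hx.2]
        calc _ ≤ ∑ j : Fin m, C₂ * (fracMajorant β f x₀ R x + fracMajorant β f x₀ R z +
              ENNReal.ofReal R ^ δ * W x₀ R) := by
              refine (enorm_sum_le _ _).trans (Finset.sum_le_sum fun j _ => ?_)
              exact (enorm_integral_le_lintegral_enorm _).trans
                (hC₂ f hvf x₀ R hR x hxB z hzB j)
          _ = _ := by
              simp only [Finset.sum_const, Finset.card_univ, Fintype.card_fin, nsmul_eq_mul]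
              ring
    have hlip : lipSeminorm w δ' F ≤ (C + 1 : ℝ≥0) * P := by
      refine iSup_le fun x₀ => iSup_le fun R => iSup_le fun hR => ENNReal.div_le_of_le_mul ?_
      have hR0 : ENNReal.ofReal R ≠ 0 := by simpa using hR
      set D := invMass w (Metric.ball x₀ R) * volume (Metric.ball x₀ R) ^ (δ' / n) with hD
      have hWD : ENNReal.ofReal R ^ (n + δ) * W x₀ R ≤ C₃ * D * P := by
        calc _ = P * (ENNReal.ofReal R ^ (n + δ) *
              ∏ i, weightNorm (v i) (p i).conjExponent κ (e i) x₀ R) := by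
              simp only [hW, hP]
              rw [Finset.prod_mul_distrib]
              ring
          _ ≤ P * (C₃ * D) := mul_le_mul' le_rfl (hC₃ x₀ R hR)
          _ = _ := by ring
      calc _ ≤ _ := (hball x₀ R hR).2
        _ ≤ 2 * (m * C₂ * (C₁ * (ENNReal.ofReal R ^ (n + δ) * W x₀ R))) +
            m * C₂ * (ENNReal.ofReal R ^ δ * W x₀ R) * (ENNReal.ofReal R ^ (n : ℝ) * ω) := by
            rw [lintegral_const_mul'' _ (hMm x₀ R), volume_ball_eq hn x₀ hR]
            gcongr
            exact hC₁ f hvf x₀ R hR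
        _ = (2 * (m * C₂ * C₁) + m * C₂ * ω) * (ENNReal.ofReal R ^ (n + δ) * W x₀ R) := by
            rw [ENNReal.rpow_add _ _ hR0 ENNReal.ofReal_ne_top]
            ring
        _ ≤ (2 * (m * C₂ * C₁) + m * C₂ * ω) * (C₃ * D * P) := mul_le_mul' le_rfl hWD
        _ = C * P * D := by
            rw [hC]
            push_cast
            rw [ENNReal.coe_toNNReal hωt]
            ring
        _ ≤ (C + 1 : ℝ≥0) * P * D := by
            gcongr
            exact le_self_add
    refine ⟨⟨fun x => ⟨Metric.ball x 1, Metric.ball_mem_nhds x one_pos,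
      (hball x 1 one_pos).1⟩, hlip.trans_lt ?_⟩, hlip⟩
    exact ENNReal.mul_lt_top ENNReal.coe_lt_top hPt.lt_top
  refine ⟨fun hconv => main _ (isCommModConst_sumCommutator hconv), ?_⟩
  -- points with measurable sections and finite majorants on all balls around the origin
  set G : Set (Rn n) := {x | (∀ j, AEStronglyMeasurable (commIntegrand K b f j x) volume) ∧
    ∀ k : ℕ, x ∈ Metric.ball (0 : Rn n) (k + 1) → fracMajorant β f 0 (k + 1) x < ∞} with hG
  have hGae : ∀ᵐ x, x ∈ G := by
    have h1 := Filter.eventually_all.2 fun j => (hI j).prodMk_left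
    have h2 : ∀ᵐ x, ∀ k : ℕ, x ∈ Metric.ball (0 : Rn n) (k + 1) →
        fracMajorant β f 0 (k + 1) x < ∞ := ae_all_iff.2 fun k =>
      (ae_restrict_iff' Metric.isOpen_ball.measurableSet).1
        (ae_lt_top' (hMm 0 (k + 1)) (hMt 0 (k + 1) (by positivity)))
    filter_upwards [h1, h2] with x hx1 hx2 using ⟨hx1, hx2⟩
  obtain ⟨F, hF⟩ := exists_isCommModConst (K := K) (b := b) (f := f) hGae fun x hx z hz j => by
    refine ⟨(hx.1 j).sub (hz.1 j), ?_⟩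
    obtain ⟨k, hk⟩ := exists_nat_gt (max ‖x‖ ‖z‖)
    have hxk : x ∈ Metric.ball (0 : Rn n) (k + 1) := by
      rw [mem_ball_zero_iff]; linarith [le_max_left ‖x‖ ‖z‖]
    have hzk : z ∈ Metric.ball (0 : Rn n) (k + 1) := by
      rw [mem_ball_zero_iff]; linarith [le_max_right ‖x‖ ‖z‖]
    have hk0 : (0 : ℝ) < k + 1 := by positivity
    refine (hC₂ f hvf 0 (k + 1) hk0 x hxk z hzk j).trans_lt ?_
    exact ENNReal.mul_lt_top ENNReal.coe_lt_top (ENNReal.add_lt_top.2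
      ⟨ENNReal.add_lt_top.2 ⟨hx.2 k hxk, hz.2 k hzk⟩,
        ENNReal.mul_lt_top (hRt _ _ hk0).lt_top (hWt 0 _ hk0).lt_top⟩)
  exact ⟨F, hF, main F hF⟩
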